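/- **Model.** Fix $p_\circ,p_\bullet\in[0,1]$, $q\in(0,1)$ and $\rho\in(0,\infty)$. Let $(N(z,0))_{z\in\mathbb Z}$ be i.i.d. Poisson($\rho$), let $S^{z,i}=(S^{z,i}_n)_{n\in\mathbb Z}$, $z\in\mathbb Z$, $i\in\mathbb N$, be independent two-sided lazy simple random walks on $\mathbb Z$ with $S^{z,i}_0=z$ (steps $-1,0,1$ with probabilities $\frac{1-q}2,q,\frac{1-q}2$; past and future of time $0$ independent), and let $(U_y)_{y\in\mathbb Z^2}$ be i.i.d. uniform on $[0,1]$, all these families being independent. Write $\mathbb P$ for their joint law, $\omega=\sum_z\sum_{1\le i\le N(z,0)}\delta_{S^{z,i}}$ for the point process of particle trajectories on the set $W$ of paths $w\colon\mathbb Z\to\mathbb Z$ with $|w(n+1)-w(n)|\le1$, and $\mathcal T\subset\mathbb Z^2$ for the set of space-time points $(x,n)$ visited by at least one particle. For $y\in\mathbb Z^2$ let $Y^y_0=y$, and let $Y^y_{n+1}=Y^y_n+(1,1)$ if either $Y^y_n\in\mathcal T$ and $U_{Y^y_n}\le p_\bullet$, or $Y^y_n\notin\mathcal T$ and $U_{Y^y_n}\le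 p_\circ$; otherwise $Y^y_{n+1}=Y^y_n+(-1,1)$. Put $Y=Y^{(0,0)}$ and let $X_n$ be the first coordinate of $Y_n$. **Assumption.** Let $0<v_\star<2p_\bullet-1$ and suppose that there are $c>0$ and $\gamma>1$ with $$\mathbb P\big(\exists\,n\ge1\colon X_n<nv_\star-L\big)\le c^{-1}e^{-c(\log L)^\gamma}\qquad\text{for all integers }L\ge1 .$$ **Regeneration time.** Put $\bar v=v_\star/3$ and, for $(x,n)\in\mathbb Z^2$, $$\angle(x,n)=(x,n)+\{(a,m)\in\mathbb Z^2\colon a\ge0,\ m\ge0,\ a\ge\bar vm\},\qquad \angle^-(x,n)=(x,n)+\{(a,m)\in\mathbb Z^2\colon a\le0,\ m\le0,\ a<\bar vm\}.$$ For $y\in\mathbb Z^2$ let $W^{\times}_y\subset W$ be the set of trajectories whose space-time trace meets both $\angle(y)$ and $\angle^-(y)$, and let $\Gamma(y)$ be the event that $\omega(W^\times_y)=0$ and $Y^y_i\in\angle(y)$ for all $i\ge0$. Let $\mathbb P^\angle=\mathbb P(\,\cdot\mid\Gamma((0,0)))$. For $k\ge1$ let $$R_k=\inf\{n\ge0\colon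 X_n\ge(1-\bar v)k+\bar vn\},$$ let $\mathcal I=\inf\{k\ge1\colon R_k<\infty\text{ and }\Gamma(Y_{R_k})\text{ occurs}\}$, and let $\tau=R_{\mathcal I}$, with $\inf\emptyset=\infty$ and $R_\infty=\infty$. **Theorem.** Almost surely on the event $\{\tau<\infty\}$, the conditional law of the process $(Y_{\tau+i}-Y_\tau)_{i\ge0}$ given $\tau$ and $(Y_i)_{0\le i\le\tau}$, under $\mathbb P$, is equal to the law of $(Y_i)_{i\ge0}$ under $\mathbb P^\angle$. The same is true of the conditional law of $(Y_{\tau+i}-Y_\tau)_{i\ge0}$ given $\tau$ and $(Y_i)_{0\le i\le\tau}$ under $\mathbb P^\angle$ (almost surely with respect to $\mathbb P^\angle$ on $\{\tau<\infty\}$). -/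

import Mathlib

open MeasureTheory ProbabilityTheory
open scoped NNReal ENNReal

namespace RWDRE

noncomputable section

/-- The parameters of the model: the probabilities `pVac`, `pOcc` of jumping to the right from a
vacant, respectively occupied, space-time point, the laziness `q` of the environment particles and
their density `ρ`. -/
structure Params where
  pVac : ℝ
  pOcc : ℝ
  q : ℝ
  ρ : ℝ≥0
  pVac_mem : pVac ∈ Set.Icc (0 : ℝ) 1
  pOcc_mem : pOcc ∈ Set.Icc (0 : ℝ) 1
  q_mem : q ∈ Set.Ioo (0 : ℝ) 1
  ρ_pos : 0 < ρ

/-- The drift `v_• = 2 p_• - 1` on occupied points. -/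
def Params.vOcc (M : Params) : ℝ := 2 * M.pOcc - 1

/-! ### The space-time lattice: points `(x, n)`, site first, time second -/

/-- The cone `∠(y)` in the first quadrant based at `y`. -/
def cone (vbar : ℝ) (y : ℤ × ℤ) : Set (ℤ × ℤ) :=
  {z | 0 ≤ z.1 - y.1 ∧ 0 ≤ z.2 - y.2 ∧ vbar * ((z.2 - y.2 : ℤ) : ℝ) ≤ ((z.1 - y.1 : ℤ) : ℝ)}

/-- The cone in the third quadrant based at `y`. -/
def backCone (vbar : ℝ) (y : ℤ × ℤ) : Set (ℤ × ℤ) :=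
  {z | z.1 - y.1 ≤ 0 ∧ z.2 - y.2 ≤ 0 ∧ ((z.1 - y.1 : ℤ) : ℝ) < vbar * ((z.2 - y.2 : ℤ) : ℝ)}

/-! ### Trajectories -/

/-- `W`: two-sided nearest-neighbour trajectories on `ℤ`, with the sigma-algebra generated by the
coordinates. -/
abbrev Traj : Type := {w : ℤ → ℤ // ∀ n, |w (n + 1) - w n| ≤ 1}

/-- The trace of a trajectory. -/
def trace (w : Traj) : Set (ℤ × ℤ) := Set.range fun n : ℤ => (w.1 n, n)

/-- The set of trajectories that intersect both cones based at `y`. -/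
def crossing (vbar : ℝ) (y : ℤ × ℤ) : Set Traj :=
  {w | (trace w ∩ cone vbar y).Nonempty ∧ (trace w ∩ backCone vbar y).Nonempty}

/-- The possible increments `-1, 0, 1` of an environment particle. -/
abbrev Step : Type := {s : ℤ // |s| ≤ 1}

/-- The two-sided path through `z` at time `0` with increments `w (n + 1) - w n = ξ n`. -/
def pathFun (z : ℤ) (ξ : ℤ → Step) (n : ℤ) : ℤ :=
  z + ∑ k ∈ Finset.Ico 0 n, (ξ k : ℤ) - ∑ k ∈ Finset.Ico n 0, (ξ k : ℤ)

theorem pathFun_succ_sub (z : ℤ) (ξ : ℤ → Step) (n : ℤ) :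
    pathFun z ξ (n + 1) - pathFun z ξ n = ξ n := by
  unfold pathFun
  rcases le_or_gt 0 n with h | h
  · have h1 : Finset.Ico (n + 1) 0 = ∅ := Finset.Ico_eq_empty (by omega)
    have h2 : Finset.Ico n 0 = ∅ := Finset.Ico_eq_empty (by omega)
    have h3 : Finset.Ico 0 (n + 1) = insert n (Finset.Ico 0 n) := by
      ext k; simp only [Finset.mem_Ico, Finset.mem_insert]; omega
    rw [h1, h2, h3, Finset.sum_insert (by simp)]
    simp
  · have h1 : Finset.Ico 0 (n + 1) = ∅ := Finset.Ico_eq_empty (by omega)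
    have h2 : Finset.Ico 0 n = ∅ := Finset.Ico_eq_empty (by omega)
    have h3 : Finset.Ico n 0 = insert n (Finset.Ico (n + 1) 0) := by
      ext k; simp only [Finset.mem_Ico, Finset.mem_insert]; omega
    rw [h1, h2, h3, Finset.sum_insert (by simp)]
    simp

/-- The trajectory through `z` at time `0` with increments `ξ`. -/
def path (z : ℤ) (ξ : ℤ → Step) : Traj :=
  ⟨pathFun z ξ, fun n => by rw [pathFun_succ_sub]; exact (ξ n).2⟩

/-! ### The probability space -/

/-- The law of one step of a lazy simple random walk. -/
def Params.stepLaw (M : Params) : Measure Step :=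
  ENNReal.ofReal ((1 - M.q) / 2) • Measure.dirac ⟨-1, by norm_num⟩
    + ENNReal.ofReal M.q • Measure.dirac ⟨0, by norm_num⟩
    + ENNReal.ofReal ((1 - M.q) / 2) • Measure.dirac ⟨1, by norm_num⟩

instance (M : Params) : IsProbabilityMeasure M.stepLaw := by
  obtain ⟨h0, h1⟩ := M.q_mem
  constructor
  simp only [Params.stepLaw, Measure.add_apply, Measure.smul_apply, measure_univ, smul_eq_mul,
    mul_one]
  rw [← ENNReal.ofReal_add (by linarith) h0.le, ← ENNReal.ofReal_add (by linarith) (by linarith)]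
  rw [show (1 - M.q) / 2 + M.q + (1 - M.q) / 2 = 1 by ring, ENNReal.ofReal_one]

/-- A sample: the numbers `N(z, 0)` of particles at time `0`, the increments at each time
`k ∈ ℤ` of the `i`-th particle starting from `z`, indexed by `(z, i, k)`, and the variables `U_y`. -/
abbrev Sample : Type :=
  (ℤ → ℕ) × ((ℤ × ℕ × ℤ) → Step) × ((ℤ × ℤ) → unitInterval)

/-- The annealed law `ℙ = ℙ^ρ`: `N(z, 0)` i.i.d. Poisson with mean `ρ`, independent lazy steps,
and i.i.d. uniform variables `U_y`, all independent. -/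
def Params.prob (M : Params) : Measure Sample :=
  (Measure.infinitePi fun _ : ℤ => poissonMeasure M.ρ).prod
    ((Measure.infinitePi fun _ : ℤ × ℕ × ℤ => M.stepLaw).prod
      (Measure.infinitePi fun _ : ℤ × ℤ => (volume : Measure unitInterval)))

instance (M : Params) : IsProbabilityMeasure M.prob := by
  unfold Params.prob; infer_instance

/-- `N(z, 0)`. -/
def initNum (s : Sample) (z : ℤ) : ℕ := s.1 z

/-- The trajectory `S^{z,i}`; the particles present at `z` at time `0` are those with
`i < N(z, 0)`. -/
def particle (s : Sample) (z : ℤ) (i : ℕ) : Traj := path z fun k => s.2.1 (z, i, k)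

/-- The variables `U_y`. -/
def unif (s : Sample) (y : ℤ × ℤ) : ℝ := s.2.2 y

/-- The point process `ω = ∑_z ∑_{i < N(z, 0)} δ_{S^{z,i}}` on the space of trajectories. -/
def pointProcess (s : Sample) : Measure Traj :=
  Measure.sum fun z : ℤ => ∑ i ∈ Finset.range (initNum s z), Measure.dirac (particle s z i)

/-- The total trace `𝒯` of the environment particles. -/
def totalTrace (s : Sample) : Set (ℤ × ℤ) :=
  ⋃ (z : ℤ) (i : ℕ) (_ : i < initNum s z), trace (particle s z i)

/-! ### The random walk -/

open Classical in
/-- The space-time random walk `Y^y`. -/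
def Params.walk (M : Params) (s : Sample) (y : ℤ × ℤ) : ℕ → ℤ × ℤ
  | 0 => y
  | n + 1 =>
    let z := M.walk s y n
    if (z ∈ totalTrace s ∧ unif s z ≤ M.pOcc) ∨ (z ∉ totalTrace s ∧ unif s z ≤ M.pVac) then
      z + (1, 1)
    else
      z + (-1, 1)

/-- `Y = Y^0`. -/
def Params.Y (M : Params) (s : Sample) : ℕ → ℤ × ℤ := M.walk s 0

/-- `X_n`, the site of the walk at time `n`. -/
def Params.X (M : Params) (s : Sample) (n : ℕ) : ℤ := (M.Y s n).1

/-- The `vstar`-ballisticity condition. -/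
def Params.Ballistic (M : Params) (vstar : ℝ) : Prop :=
  ∃ c > (0 : ℝ), ∃ γ > (1 : ℝ), ∀ L : ℕ, 1 ≤ L →
    M.prob.real {s | ∃ n : ℕ, 1 ≤ n ∧ (M.X s n : ℝ) < n * vstar - L}
      ≤ c⁻¹ * Real.exp (-c * Real.log L ^ γ)

/-! ### Regeneration -/

/-- The event `A^y` that the walk started at `y` stays in `∠(y)`. -/
def Params.stays (M : Params) (vbar : ℝ) (y : ℤ × ℤ) : Set Sample :=
  {s | ∀ i : ℕ, M.walk s y i ∈ cone vbar y}

/-- The event that no particle trajectory intersects both cones at `y` and that `A^y` occurs. -/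
def Params.good (M : Params) (vbar : ℝ) (y : ℤ × ℤ) : Set Sample :=
  {s | pointProcess s (crossing vbar y) = 0} ∩ M.stays vbar y

/-- The measure `ℙ^∠`. -/
def Params.probCone (M : Params) (vbar : ℝ) : Measure Sample :=
  ProbabilityTheory.cond M.prob (M.good vbar 0)

instance (M : Params) (vbar : ℝ) : IsFiniteMeasure (M.probCone vbar) := by
  unfold Params.probCone; infer_instance

/-- The record times `R_k`, with `inf ∅ = ∞`. -/
def Params.record (M : Params) (vbar : ℝ) (s : Sample) (k : ℕ) : ℕ∞ :=
  sInf ((fun n : ℕ => (n : ℕ∞)) '' {n | (1 - vbar) * k + vbar * n ≤ M.X s n})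

/-- The regeneration record index `ℐ`, with `inf ∅ = ∞`. -/
def Params.regIndex (M : Params) (vbar : ℝ) (s : Sample) : ℕ∞ :=
  sInf ((fun k : ℕ => (k : ℕ∞)) ''
    {k | 1 ≤ k ∧ M.record vbar s k < ⊤ ∧ s ∈ M.good vbar (M.Y s (M.record vbar s k).toNat)})

open Classical in
/-- The regeneration time `τ = R_ℐ`, infinite if `ℐ` is. -/
def Params.regTime (M : Params) (vbar : ℝ) (s : Sample) : ℕ∞ :=
  if M.regIndex vbar s < ⊤ then M.record vbar s (M.regIndex vbar s).toNat else ⊤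

open Classical in
/-- The data `(τ, (Y_i)_{0 ≤ i ≤ τ})`; the path up to time `τ` is encoded as the path stopped at
time `τ`. -/
def Params.past (M : Params) (vbar : ℝ) (s : Sample) : ℕ∞ × (ℕ → ℤ × ℤ) :=
  (M.regTime vbar s,
    fun i => if (i : ℕ∞) ≤ M.regTime vbar s then M.Y s i else M.Y s (M.regTime vbar s).toNat)

/-- The increments `(Y_{τ+i} - Y_τ)_i` after time `τ` (only relevant if `τ < ∞`). -/
def Params.future (M : Params) (vbar : ℝ) (s : Sample) : ℕ → ℤ × ℤ :=
  fun i => M.Y s ((M.regTime vbar s).toNat + i) - M.Y s (M.regTime vbar s).toNat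

end

end RWDRE

/-! The proof computes the joint probability of one complete past and an arbitrary future. Fix a
time `n` and a path `f` stopped at `n`, and put `y = f n`. If the past is `(n, f)`, no trajectory
meets both cones at `y`. Since `n` is a record time, the earlier points of `f` lie in the back cone
of `y`. Hence they can only be occupied by trajectories that avoid `cone y`, and the uniforms used
before time `n` sit in the back cone. The failure of regeneration at earlier records also becomes an
event behind `y`: if `y` lies in the cone of an earlier point `z`, a trajectory crossing at `z` and
meeting `cone y` would cross at `y` as well. Thus the event "past `(n, f)`, future in `D`" is
`pastBehind`, a function of trajectories avoiding `cone y` and uniforms in the back cone,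
intersected with `goodFuture`, a function of trajectories meeting `cone y` and uniforms in `cone y`
(`past_eq_iff_pastBehind`, `past_inter_future`).

The two events are independent, and by stationarity the second has the same probability at `y` as at
`0` (`indep_localSigma`, `prob_goodFuture`, `prob_inter_goodFuture`). Both facts rest on void
probabilities alone: the chance of no particle in `K` is `exp (-ρ μ K)`, where `μ` is the sum over
`z` of the laws of the walks from `z` (`prob_avoids`). Additivity of `μ` gives independence, and its
shift invariance gives stationarity.

The joint law is therefore a constant depending on the past times the measure `D ↦ P(good at 0, Y ∈
D)`. Finite pasts are countably many, so the conditional law is elementary, and normalising yields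
the law of `Y` under `probCone` (`condDistrib_eq_cond_map`). Under `probCone` the extra event "good
at `0`" is, given the past, one more event behind `y` (`good_inter_past`), so it changes only the
constant. -/

namespace RWDRE

open Filter Topology

/-! ### Auxiliary facts on exponentials and Poisson laws -/

/-- The function `x ↦ exp (-x)` on `[0, ∞]`. -/
noncomputable def expNeg (x : ℝ≥0∞) : ℝ≥0∞ := EReal.exp (-(x : EReal))

/-- Continuity up to `∞`, where the value is `0`, makes the void formula valid for sets of infinite
intensity without a case split. -/
theorem continuous_expNeg : Continuous expNeg :=
  ENNReal.continuous_exp.comp (continuous_neg.comp continuous_coe_ennreal_ereal)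

theorem expNeg_zero : expNeg 0 = 1 := by simp [expNeg]

theorem expNeg_add (x y : ℝ≥0∞) : expNeg (x + y) = expNeg x * expNeg y := by
  unfold expNeg
  rw [EReal.coe_ennreal_add, EReal.neg_add (by simp) (by simp), sub_eq_add_neg, EReal.exp_add]

theorem expNeg_sum {ι : Type*} (F : Finset ι) (f : ι → ℝ≥0∞) :
    expNeg (∑ z ∈ F, f z) = ∏ z ∈ F, expNeg (f z) := by
  classical
  induction F using Finset.induction_on with
  | empty => simp [expNeg_zero]
  | insert a F ha ih => rw [Finset.sum_insert ha, Finset.prod_insert ha, expNeg_add, ih]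

theorem expNeg_ofReal {x : ℝ} (hx : 0 ≤ x) :
    expNeg (ENNReal.ofReal x) = ENNReal.ofReal (Real.exp (-x)) := by
  unfold expNeg
  rw [EReal.coe_ennreal_ofReal, max_eq_left hx, ← EReal.coe_neg, EReal.exp_coe]

/-- This is the Poisson generating function: each of a Poisson number of particles at a site misses
`K` with probability `q`. -/
theorem lintegral_pow_poissonMeasure (r : ℝ≥0) {p q : ℝ≥0∞} (hpq : p + q = 1) :
    ∫⁻ n, q ^ n ∂(poissonMeasure r) = expNeg (r * p) := by
  have hp : p ≠ ∞ := by rintro rfl; simp at hpq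
  have hq : q ≠ ∞ := by rintro rfl; simp at hpq
  lift p to ℝ≥0 using hp
  lift q to ℝ≥0 using hq
  have hpq' : (p : ℝ) + q = 1 := by exact_mod_cast hpq
  rw [poissonMeasure, lintegral_sum_measure]
  simp only [lintegral_smul_measure, lintegral_dirac, smul_eq_mul]
  have h1 : ∀ n : ℕ, ENNReal.ofReal (Real.exp (-r) * r ^ n / (n.factorial)) * (q : ℝ≥0∞) ^ n
      = ENNReal.ofReal (Real.exp (-r) * ((r * q : ℝ) ^ n / (n.factorial))) := by
    intro n
    rw [show ((q : ℝ≥0∞) ^ n) = ENNReal.ofReal ((q : ℝ) ^ n) by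
      rw [ENNReal.ofReal_pow (by positivity), ENNReal.ofReal_coe_nnreal],
      ← ENNReal.ofReal_mul (by positivity)]
    congr 1
    rw [mul_pow]; ring
  have h2 := ((NormedSpace.expSeries_div_hasSum_exp (r * q : ℝ)).mul_left (Real.exp (-r)))
  rw [← Real.exp_eq_exp_ℝ, ← Real.exp_add] at h2
  simp_rw [h1]
  rw [← ENNReal.ofReal_tsum_of_nonneg (fun n => by positivity) h2.summable, h2.tsum_eq,
    show ((r : ℝ≥0∞) * p) = ENNReal.ofReal ((r : ℝ) * p) by
      rw [ENNReal.ofReal_mul (by positivity), ENNReal.ofReal_coe_nnreal,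
        ENNReal.ofReal_coe_nnreal], expNeg_ofReal (by positivity)]
  congr 2
  have : (q : ℝ) = 1 - p := by linarith
  rw [this]; ring

/-! ### Void events -/

theorem measurable_path (z : ℤ) : Measurable (path z) := by
  refine Measurable.subtype_mk (measurable_pi_lambda _ fun n => ?_)
  unfold pathFun
  have h : ∀ k, Measurable fun ξ : ℤ → Step => (ξ k : ℤ) :=
    fun k => measurable_subtype_coe.comp (measurable_pi_apply k)
  exact ((Finset.measurable_sum _ fun k _ => h k).const_add z).sub
    (Finset.measurable_sum _ fun k _ => h k)

/-- The event that no particle trajectory belongs to `K`. -/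
def avoids (K : Set Traj) : Set Sample :=
  {s | ∀ z i, i < initNum s z → particle s z i ∉ K}

theorem avoids_union (K L : Set Traj) : avoids (K ∪ L) = avoids K ∩ avoids L := by
  ext s
  simp only [avoids, Set.mem_ofPred_eq, Set.mem_union, not_or, Set.mem_inter_iff]
  exact ⟨fun h => ⟨fun z i hi => (h z i hi).1, fun z i hi => (h z i hi).2⟩,
    fun h z i hi => ⟨h.1 z i hi, h.2 z i hi⟩⟩

theorem avoids_anti {K L : Set Traj} (h : K ⊆ L) : avoids L ⊆ avoids K :=
  fun _ hs z i hi hK => hs z i hi (h hK)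

theorem avoids_iUnion {ι : Sort*} (K : ι → Set Traj) : avoids (⋃ j, K j) = ⋂ j, avoids (K j) := by
  ext s
  simp only [avoids, Set.mem_ofPred_eq, Set.mem_iUnion, not_exists, Set.mem_iInter]
  exact ⟨fun h j z i hi => h z i hi j, fun h z i hi j => h j z i hi⟩

/-- The environment variables of the sample. -/
def envVar (s : Sample) : (ℤ → ℕ) × ((ℤ × ℕ × ℤ) → Step) := (s.1, s.2.1)

theorem measurable_envVar : Measurable envVar :=
  measurable_fst.prodMk (measurable_fst.comp measurable_snd)

/-- The void event restricted to particles starting from `F`. -/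
def avoidsOn (F : Set ℤ) (K : Set Traj) : Set ((ℤ → ℕ) × ((ℤ × ℕ × ℤ) → Step)) :=
  {e | ∀ z ∈ F, ∀ i, i < e.1 z → path z (fun k => e.2 (z, i, k)) ∉ K}

theorem avoids_eq_preimage (K : Set Traj) : avoids K = envVar ⁻¹' avoidsOn Set.univ K := by
  ext s
  simp [avoids, avoidsOn, envVar, initNum, particle]

theorem measurableSet_avoidsOn (F : Set ℤ) {K : Set Traj} (hK : MeasurableSet K) :
    MeasurableSet (avoidsOn F K) := by
  have : avoidsOn F K = ⋂ z ∈ F, ⋂ i : ℕ,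
      ({e | i < e.1 z}ᶜ ∪ (fun e : (ℤ → ℕ) × ((ℤ × ℕ × ℤ) → Step) =>
        path z (fun k => e.2 (z, i, k))) ⁻¹' Kᶜ) := by
    ext e
    simp only [avoidsOn, Set.mem_ofPred_eq, Set.mem_iInter, Set.mem_union, Set.mem_compl_iff,
      Set.mem_preimage, imp_iff_not_or]
  rw [this]
  refine MeasurableSet.biInter (Set.to_countable F) fun z _ => MeasurableSet.iInter fun i => ?_
  refine MeasurableSet.union (MeasurableSet.compl ?_) ?_
  · exact measurableSet_lt measurable_const ((measurable_pi_apply z).comp measurable_fst)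
  · have h : Measurable fun (e : (ℤ → ℕ) × ((ℤ × ℕ × ℤ) → Step)) (k : ℤ) => e.2 (z, i, k) := by
      fun_prop
    exact ((measurable_path z).comp h) hK.compl

theorem measurableSet_avoids {K : Set Traj} (hK : MeasurableSet K) :
    MeasurableSet (avoids K) := by
  rw [avoids_eq_preimage]
  exact measurable_envVar (measurableSet_avoidsOn _ hK)

theorem pointProcess_eq_zero_iff {K : Set Traj} (hK : MeasurableSet K) (s : Sample) :
    pointProcess s K = 0 ↔ s ∈ avoids K := by
  rw [pointProcess, Measure.sum_apply _ hK, ENNReal.tsum_eq_zero]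
  simp only [Measure.coe_finsetSum, Finset.sum_apply, Finset.sum_eq_zero_iff, Finset.mem_range,
    Measure.dirac_apply' _ hK, Set.indicator_apply_eq_zero, Pi.one_apply, one_ne_zero, imp_false]
  rfl

/-- The set of trajectories through the space-time point `x`. -/
def through (x : ℤ × ℤ) : Set Traj := {w | w.1 x.2 = x.1}

theorem measurable_trajEval (n : ℤ) : Measurable fun w : Traj => w.1 n :=
  (measurable_pi_apply (X := fun _ : ℤ => ℤ) n).comp measurable_subtype_coe

theorem measurableSet_through (x : ℤ × ℤ) : MeasurableSet (through x) :=
  measurable_trajEval x.2 (measurableSet_singleton x.1)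

theorem mem_trace_iff (w : Traj) (x : ℤ × ℤ) : x ∈ trace w ↔ w ∈ through x := by
  simp only [trace, Set.mem_range, through, Set.mem_ofPred_eq]
  constructor
  · rintro ⟨n, rfl⟩; rfl
  · intro h; exact ⟨x.2, Prod.ext h rfl⟩

theorem mem_totalTrace_iff (s : Sample) (x : ℤ × ℤ) :
    x ∈ totalTrace s ↔ s ∉ avoids (through x) := by
  simp only [totalTrace, Set.mem_iUnion, mem_trace_iff, avoids, Set.mem_ofPred_eq, not_forall,
    not_not]

/-- The set of trajectories whose trace meets `S`. -/
def meets (S : Set (ℤ × ℤ)) : Set Traj := ⋃ x ∈ S, through x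

theorem measurableSet_meets (S : Set (ℤ × ℤ)) : MeasurableSet (meets S) :=
  MeasurableSet.biUnion (Set.to_countable S) fun x _ => measurableSet_through x

theorem nonempty_trace_inter_iff (w : Traj) (S : Set (ℤ × ℤ)) :
    (trace w ∩ S).Nonempty ↔ w ∈ meets S := by
  simp only [Set.Nonempty, Set.mem_inter_iff, mem_trace_iff, meets, Set.mem_iUnion, exists_prop,
    and_comm]

theorem crossing_eq (vbar : ℝ) (y : ℤ × ℤ) :
    crossing vbar y = meets (cone vbar y) ∩ meets (backCone vbar y) := by
  ext w
  simp only [crossing, Set.mem_ofPred_eq, nonempty_trace_inter_iff, Set.mem_inter_iff]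

theorem measurableSet_crossing (vbar : ℝ) (y : ℤ × ℤ) : MeasurableSet (crossing vbar y) := by
  rw [crossing_eq]
  exact (measurableSet_meets _).inter (measurableSet_meets _)

/-! ### Void probabilities -/

/-- The law of the increments of one particle. -/
noncomputable def Params.incLaw (M : Params) : Measure (ℤ → Step) :=
  Measure.infinitePi fun _ : ℤ => M.stepLaw

instance (M : Params) : IsProbabilityMeasure M.incLaw := by
  unfold Params.incLaw; infer_instance

/-- The measure `∑_z P(S^z ∈ ·)` on trajectories. -/
noncomputable def Params.trajMeasure (M : Params) : Measure Traj :=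
  Measure.sum fun z : ℤ => M.incLaw.map (path z)

/-- The joint law of the environment variables. -/
noncomputable def Params.envLaw (M : Params) : Measure ((ℤ → ℕ) × ((ℤ × ℕ × ℤ) → Step)) :=
  (Measure.infinitePi fun _ : ℤ => poissonMeasure M.ρ).prod
    (Measure.infinitePi fun _ : ℤ × ℕ × ℤ => M.stepLaw)

instance (M : Params) : IsProbabilityMeasure M.envLaw := by
  unfold Params.envLaw; infer_instance

theorem infinitePi_steps_avoid (M : Params) (F : Finset ℤ) (n : ℤ → ℕ) {K : Set Traj}
    (hK : MeasurableSet K) :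
    (Measure.infinitePi fun _ : ℤ × ℕ × ℤ => M.stepLaw)
        {ξ | ∀ z ∈ F, ∀ i, i < n z → path z (fun k => ξ (z, i, k)) ∉ K}
      = ∏ z ∈ F, (M.incLaw (path z ⁻¹' Kᶜ)) ^ n z := by
  classical
  -- Regroup the indices `(z, i, k)` as `((z, i), k)` and curry, so that the increments form an
  -- independent family of sequences, one per particle.
  have h1 : (Measure.infinitePi fun _ : ℤ × ℕ × ℤ => M.stepLaw).map
      (fun ξ (p : (ℤ × ℕ) × ℤ) => ξ (p.1.1, p.1.2, p.2)) =
      Measure.infinitePi fun _ : (ℤ × ℕ) × ℤ => M.stepLaw :=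
    Measure.map_infinitePi_infinitePi_of_inj (P := fun _ : ℤ × ℕ × ℤ => M.stepLaw)
      (f := fun p : (ℤ × ℕ) × ℤ => (p.1.1, p.1.2, p.2))
      (fun p p' h => by simp only [Prod.mk.injEq] at h; ext <;> simp [h])
  have h2 := Measure.infinitePi_map_curry (ι := ℤ × ℕ) (κ := ℤ) (fun _ _ => M.stepLaw)
  rw [← h1, Measure.map_map (by fun_prop) (by fun_prop)] at h2
  set G : Finset (ℤ × ℕ) := (F.sigma fun z => Finset.range (n z)).map
    (Equiv.sigmaEquivProd ℤ ℕ).toEmbedding with hG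
  have h3 : {ξ : ℤ × ℕ × ℤ → Step | ∀ z ∈ F, ∀ i, i < n z → path z (fun k => ξ (z, i, k)) ∉ K}
      = ((MeasurableEquiv.curry (ℤ × ℕ) ℤ Step) ∘
        (fun ξ (p : (ℤ × ℕ) × ℤ) => ξ (p.1.1, p.1.2, p.2))) ⁻¹'
        (Set.pi G fun p => path p.1 ⁻¹' Kᶜ) := by
    ext ξ
    simp only [Set.mem_ofPred_eq, Set.mem_preimage, Set.mem_pi, Function.comp, hG, Finset.coe_map,
      Set.mem_image, Finset.mem_coe, Finset.mem_sigma, Finset.mem_range]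
    constructor
    · rintro h _ ⟨⟨z, i⟩, ⟨hz, hi⟩, rfl⟩
      exact h z hz i hi
    · intro h z hz i hi
      exact h (z, i) ⟨⟨z, i⟩, ⟨hz, hi⟩, rfl⟩
  rw [h3, ← Measure.map_apply (by fun_prop)
    (MeasurableSet.pi (Finset.countable_toSet _) fun p _ => measurable_path _ hK.compl), h2,
    Measure.infinitePi_pi _ (fun p _ => measurable_path _ hK.compl), hG, Finset.prod_map,
    Finset.prod_sigma]
  refine Finset.prod_congr rfl fun z _ => ?_
  simp [Params.incLaw]

/-- Given the particle numbers, the void event has a product of powers as its probability;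
independence over sites and the generating function then integrate this product. -/
theorem envLaw_avoidsOn (M : Params) (F : Finset ℤ) {K : Set Traj} (hK : MeasurableSet K) :
    M.envLaw (avoidsOn F K) = expNeg (∑ z ∈ F, M.ρ * (M.incLaw.map (path z)) K) := by
  rw [Params.envLaw, Measure.prod_apply (measurableSet_avoidsOn _ hK)]
  have : ∀ n : ℤ → ℕ, (Measure.infinitePi fun _ : ℤ × ℕ × ℤ => M.stepLaw)
      (Prod.mk n ⁻¹' avoidsOn F K) = ∏ z ∈ F, (M.incLaw (path z ⁻¹' Kᶜ)) ^ n z :=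
    fun n => infinitePi_steps_avoid M F n hK
  simp_rw [this]
  have hind := iIndepFun_infinitePi (P := fun _ : ℤ => poissonMeasure M.ρ)
    (X := fun z n => (M.incLaw (path z ⁻¹' Kᶜ)) ^ n) (fun z => .of_discrete)
  rw [lintegral_prod_eq_prod_lintegral_of_indepFun F _ hind (by fun_prop), expNeg_sum]
  refine Finset.prod_congr rfl fun z _ => ?_
  rw [← lintegral_pow_poissonMeasure M.ρ (q := M.incLaw (path z ⁻¹' Kᶜ)),
    ← (measurePreserving_eval_infinitePi (fun _ : ℤ => poissonMeasure M.ρ) z).lintegral_comp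
      .of_discrete]
  rw [Measure.map_apply (measurable_path z) hK]
  exact prob_add_prob_compl (measurable_path z hK)

theorem map_envVar (M : Params) : M.prob.map envVar = M.envLaw := by
  unfold Params.prob
  have h : envVar = Prod.map id Prod.fst := rfl
  rw [h, ← Measure.map_prod_map _ _ measurable_id measurable_fst, Measure.map_id,
    Measure.map_fst_prod, measure_univ, one_smul]
  rfl

/-- Let the finite set of starting sites increase to `ℤ`: the void events decrease, and the
exponents converge to the full sum. -/
theorem prob_avoids (M : Params) {K : Set Traj} (hK : MeasurableSet K) :
    M.prob (avoids K) = expNeg (M.ρ * M.trajMeasure K) := by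
  rw [avoids_eq_preimage, ← Measure.map_apply measurable_envVar (measurableSet_avoidsOn _ hK),
    map_envVar]
  have h1 : avoidsOn Set.univ K = ⋂ F : Finset ℤ, avoidsOn F K := by
    ext e
    simp only [avoidsOn, Set.mem_univ, Set.mem_ofPred_eq, Set.mem_iInter]
    exact ⟨fun h F z _ => h z trivial, fun h z _ => h {z} z (by simp)⟩
  have h2 : Tendsto (fun F : Finset ℤ => M.envLaw (avoidsOn F K)) atTop
      (𝓝 (M.envLaw (⋂ F : Finset ℤ, avoidsOn F K))) :=
    tendsto_measure_iInter_atTop (fun F => (measurableSet_avoidsOn _ hK).nullMeasurableSet)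
      (fun F G hFG e he z hz => he z (hFG hz)) ⟨∅, measure_ne_top _ _⟩
  have h3 : Tendsto (fun F : Finset ℤ => M.envLaw (avoidsOn F K)) atTop
      (𝓝 (expNeg (M.ρ * M.trajMeasure K))) := by
    simp_rw [envLaw_avoidsOn M _ hK]
    refine (continuous_expNeg.tendsto _).comp ?_
    rw [Params.trajMeasure, Measure.sum_apply _ hK, ← ENNReal.tsum_mul_left]
    exact ENNReal.summable.hasSum
  rw [h1]
  exact tendsto_nhds_unique h2 h3

theorem prob_avoids_inter (M : Params) {K L : Set Traj} (hK : MeasurableSet K)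
    (hL : MeasurableSet L) (hKL : Disjoint K L) :
    M.prob (avoids K ∩ avoids L) = M.prob (avoids K) * M.prob (avoids L) := by
  rw [← avoids_union, prob_avoids M (hK.union hL), measure_union hKL hL, mul_add, expNeg_add,
    prob_avoids M hK, prob_avoids M hL]

/-! ### Space-time shifts -/

/-- The trajectory `w` seen from the space-time point `y`. -/
def shiftTraj (y : ℤ × ℤ) (w : Traj) : Traj :=
  ⟨fun n => w.1 (n + y.2) - y.1, fun n => by
    have := w.2 (n + y.2)
    rw [show n + y.2 + 1 = n + 1 + y.2 by ring] at this
    rwa [show w.1 (n + 1 + y.2) - y.1 - (w.1 (n + y.2) - y.1)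
      = w.1 (n + 1 + y.2) - w.1 (n + y.2) by ring]⟩

theorem measurable_shiftTraj (y : ℤ × ℤ) : Measurable (shiftTraj y) :=
  Measurable.subtype_mk (measurable_pi_lambda _ fun n =>
    (measurable_trajEval (n + y.2)).sub_const _)

theorem eq_of_succ_sub_eq {f g : ℤ → ℤ} (h0 : f 0 = g 0)
    (h : ∀ n, f (n + 1) - f n = g (n + 1) - g n) : f = g := by
  have : ∀ n : ℤ, f n - g n = 0 := by
    intro n
    induction n using Int.induction_on with
    | zero => omega
    | succ i ih => have := h i; omega
    | pred i ih => have := h (-i - 1); rw [sub_add_cancel] at this; omega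
  funext n
  have := this n
  omega

/-- What matters is that the displacement of the starting point depends on `ξ` but not on `z`. -/
theorem shiftTraj_path (y : ℤ × ℤ) (z : ℤ) (ξ : ℤ → Step) :
    shiftTraj y (path z ξ) = path (z + (pathFun 0 ξ y.2 - y.1)) (fun k => ξ (k + y.2)) := by
  refine Subtype.ext (eq_of_succ_sub_eq ?_ fun n => ?_)
  · simp only [shiftTraj, path, pathFun]
    simp
    ring
  · simp only [shiftTraj, path]
    rw [pathFun_succ_sub, ← pathFun_succ_sub z ξ (n + y.2),
      show n + y.2 + 1 = n + 1 + y.2 by ring]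
    ring

/-- The law of one walk is not invariant, but the sum over starting sites is: for fixed increments
the shift merely translates the summation index, and the increment law is invariant under time
shifts. -/
theorem map_shiftTraj (M : Params) (y : ℤ × ℤ) :
    M.trajMeasure.map (shiftTraj y) = M.trajMeasure := by
  ext K hK
  rw [Measure.map_apply (measurable_shiftTraj y) hK, Params.trajMeasure,
    Measure.sum_apply _ (measurable_shiftTraj y hK), Measure.sum_apply _ hK]
  have hsh : M.incLaw.map (fun ξ k => ξ (k + y.2)) = M.incLaw :=
    Measure.map_infinitePi_infinitePi_of_inj (P := fun _ : ℤ => M.stepLaw)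
      (f := fun k : ℤ => k + y.2) (add_left_injective y.2)
  have hshm : Measurable (fun (ξ : ℤ → Step) (k : ℤ) => ξ (k + y.2)) := by fun_prop
  have hi : ∀ z, Measurable fun ξ : ℤ → Step => K.indicator (1 : Traj → ℝ≥0∞) (path z ξ) :=
    fun z => (measurable_one.indicator hK).comp (measurable_path z)
  calc ∑' z, (M.incLaw.map (path z)) (shiftTraj y ⁻¹' K)
      = ∑' z, ∫⁻ ξ, K.indicator 1 (shiftTraj y (path z ξ)) ∂M.incLaw := by
        refine tsum_congr fun z => ?_
        rw [Measure.map_apply (measurable_path z) (measurable_shiftTraj y hK),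
          ← lintegral_indicator_one (measurable_path z (measurable_shiftTraj y hK))]
        rfl
    _ = ∫⁻ ξ, ∑' z, K.indicator 1 (shiftTraj y (path z ξ)) ∂M.incLaw :=
        (lintegral_tsum fun z => ((measurable_one.indicator hK).comp
          ((measurable_shiftTraj y).comp (measurable_path z))).aemeasurable).symm
    _ = ∫⁻ ξ, ∑' z, K.indicator 1 (path z (fun k => ξ (k + y.2))) ∂M.incLaw := by
        refine lintegral_congr fun ξ => ?_
        simp_rw [shiftTraj_path]
        exact (Equiv.addRight (pathFun 0 ξ y.2 - y.1)).tsum_eq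
          (fun z => K.indicator (1 : Traj → ℝ≥0∞) (path z (fun k => ξ (k + y.2))))
    _ = ∑' z, ∫⁻ ξ, K.indicator 1 (path z (fun k => ξ (k + y.2))) ∂M.incLaw :=
        lintegral_tsum fun z => ((hi z).comp hshm).aemeasurable
    _ = ∑' z, (M.incLaw.map (path z)) K := by
        refine tsum_congr fun z => ?_
        rw [Measure.map_apply (measurable_path z) hK,
          ← lintegral_indicator_one (measurable_path z hK)]
        conv_rhs => rw [← hsh, lintegral_map (measurable_one.indicator (measurable_path z hK)) hshm]
        rfl

theorem shiftTraj_preimage_through (y x : ℤ × ℤ) :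
    shiftTraj y ⁻¹' through x = through (x + y) := by
  ext w
  simp only [shiftTraj, through, Set.mem_preimage, Set.mem_ofPred_eq, Prod.fst_add, Prod.snd_add]
  omega

theorem shiftTraj_preimage_meets {y : ℤ × ℤ} {S T : Set (ℤ × ℤ)} (h : ∀ x, x ∈ S ↔ x + y ∈ T) :
    shiftTraj y ⁻¹' meets S = meets T := by
  ext w
  simp only [meets, Set.preimage_iUnion, shiftTraj_preimage_through, Set.mem_iUnion, exists_prop]
  constructor
  · rintro ⟨x, hx, hw⟩; exact ⟨_, (h x).1 hx, hw⟩
  · rintro ⟨x, hx, hw⟩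
    exact ⟨x - y, (h _).2 (by rwa [sub_add_cancel]), by rwa [sub_add_cancel]⟩

theorem add_mem_cone_iff (vbar : ℝ) (x y : ℤ × ℤ) : x ∈ cone vbar 0 ↔ x + y ∈ cone vbar y := by
  simp [cone]

theorem add_mem_backCone_iff (vbar : ℝ) (x y : ℤ × ℤ) :
    x ∈ backCone vbar 0 ↔ x + y ∈ backCone vbar y := by
  simp [backCone]

theorem shiftTraj_preimage_crossing (vbar : ℝ) (y : ℤ × ℤ) :
    shiftTraj y ⁻¹' crossing vbar 0 = crossing vbar y := by
  rw [crossing_eq, crossing_eq, Set.preimage_inter,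
    shiftTraj_preimage_meets fun x => add_mem_cone_iff vbar x y,
    shiftTraj_preimage_meets fun x => add_mem_backCone_iff vbar x y]

theorem prob_avoids_shift (M : Params) (y : ℤ × ℤ) {K : Set Traj} (hK : MeasurableSet K) :
    M.prob (avoids (shiftTraj y ⁻¹' K)) = M.prob (avoids K) := by
  rw [prob_avoids M (measurable_shiftTraj y hK), prob_avoids M hK,
    ← Measure.map_apply (measurable_shiftTraj y) hK, map_shiftTraj]

/-! ### Independence of the environment in disjoint regions -/

theorem isPiSystem_image2_inter {Ω : Type*} (m₁ m₂ : MeasurableSpace Ω) :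
    IsPiSystem (Set.image2 (· ∩ ·) {s | MeasurableSet[m₁] s} {s | MeasurableSet[m₂] s}) := by
  rintro _ ⟨a, ha, b, hb, rfl⟩ _ ⟨c, hc, d, hd, rfl⟩ -
  exact ⟨a ∩ c, MeasurableSet.inter ha hc, b ∩ d, MeasurableSet.inter hb hd,
    Set.inter_inter_inter_comm a c b d⟩

theorem sup_eq_generateFrom_image2_inter {Ω : Type*} (m₁ m₂ : MeasurableSpace Ω) :
    m₁ ⊔ m₂ = MeasurableSpace.generateFrom
      (Set.image2 (· ∩ ·) {s | MeasurableSet[m₁] s} {s | MeasurableSet[m₂] s}) := by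
  apply le_antisymm
  · refine sup_le (fun s hs => ?_) (fun s hs => ?_)
    · exact MeasurableSpace.measurableSet_generateFrom
        ⟨s, hs, Set.univ, MeasurableSet.univ, Set.inter_univ s⟩
    · exact MeasurableSpace.measurableSet_generateFrom
        ⟨Set.univ, MeasurableSet.univ, s, hs, Set.univ_inter s⟩
  · refine MeasurableSpace.generateFrom_le ?_
    rintro _ ⟨a, ha, b, hb, rfl⟩
    exact MeasurableSet.inter (le_sup_left (a := m₁) (b := m₂) a ha)
      (le_sup_right (a := m₁) (b := m₂) b hb)

/-- Regroups independence of (environment, uniforms) into independence of (region, disjoint region),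
by factoring probabilities on the generating π-systems of intersections. -/
theorem indep_sup_sup {Ω : Type*} {m₁ m₁' m₂ m₂' m : MeasurableSpace Ω} {μ : Measure Ω}
    [IsProbabilityMeasure μ] (h₁ : m₁ ≤ m) (h₁' : m₁' ≤ m) (h₂ : m₂ ≤ m) (h₂' : m₂' ≤ m)
    (h : Indep (m₁ ⊔ m₁') (m₂ ⊔ m₂') μ) (hi₁ : Indep m₁ m₁' μ) (hi₂ : Indep m₂ m₂' μ) :
    Indep (m₁ ⊔ m₂) (m₁' ⊔ m₂') μ := by
  refine IndepSets.indep (sup_le h₁ h₂) (sup_le h₁' h₂') (isPiSystem_image2_inter m₁ m₂)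
    (isPiSystem_image2_inter m₁' m₂') (sup_eq_generateFrom_image2_inter _ _)
    (sup_eq_generateFrom_image2_inter _ _) ?_
  rw [IndepSets_iff]
  rintro _ _ ⟨a, ha, b, hb, rfl⟩ ⟨c, hc, d, hd, rfl⟩
  rw [Indep_iff] at h hi₁ hi₂
  have ha' := le_sup_left (a := m₁) (b := m₁') a ha
  have hc' := le_sup_right (a := m₁) (b := m₁') c hc
  have hb' := le_sup_left (a := m₂) (b := m₂') b hb
  have hd' := le_sup_right (a := m₂) (b := m₂') d hd
  simp only
  rw [Set.inter_inter_inter_comm, h _ _ (MeasurableSet.inter ha' hc') (MeasurableSet.inter hb' hd'),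
    hi₁ _ _ ha hc, hi₂ _ _ hb hd, h _ _ ha' hb', h _ _ hc' hd']
  ring

/-- The sigma-algebra generated by the void events of subsets of `A`. -/
@[reducible] def voidSigma (A : Set Traj) : MeasurableSpace Sample :=
  MeasurableSpace.generateFrom {S | ∃ K, K ⊆ A ∧ MeasurableSet K ∧ S = avoids K}

/-- The sigma-algebra generated by the variables `U_x`, `x ∈ F`. -/
@[reducible] def unifSigma (F : Set (ℤ × ℤ)) : MeasurableSpace Sample :=
  ⨆ x ∈ F, MeasurableSpace.comap (fun s : Sample => s.2.2 x) inferInstance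

/-- The sigma-algebra generated by the void events of subsets of `A` and by `U_x`, `x ∈ F`. -/
@[reducible] def localSigma (A : Set Traj) (F : Set (ℤ × ℤ)) : MeasurableSpace Sample :=
  voidSigma A ⊔ unifSigma F

theorem voidSigma_le_envVar (A : Set Traj) :
    voidSigma A ≤ MeasurableSpace.comap envVar inferInstance := by
  refine MeasurableSpace.generateFrom_le ?_
  rintro _ ⟨K, -, hK, rfl⟩
  exact ⟨_, measurableSet_avoidsOn Set.univ hK, (avoids_eq_preimage K).symm⟩

theorem voidSigma_le (A : Set Traj) : voidSigma A ≤ (inferInstance : MeasurableSpace Sample) :=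
  (voidSigma_le_envVar A).trans measurable_envVar.comap_le

theorem measurable_unifVar : Measurable fun s : Sample => s.2.2 :=
  measurable_snd.comp measurable_snd

theorem measurable_unifVar_apply (x : ℤ × ℤ) : Measurable fun s : Sample => s.2.2 x :=
  (measurable_pi_apply x).comp measurable_unifVar

theorem unifSigma_le_unifVar (F : Set (ℤ × ℤ)) :
    unifSigma F ≤ MeasurableSpace.comap (fun s : Sample => s.2.2) inferInstance := by
  refine iSup₂_le fun x _ => ?_
  rintro _ ⟨B, hB, rfl⟩
  exact ⟨_, measurable_pi_apply x hB, rfl⟩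

theorem unifSigma_le (F : Set (ℤ × ℤ)) : unifSigma F ≤ (inferInstance : MeasurableSpace Sample) :=
  (unifSigma_le_unifVar F).trans measurable_unifVar.comap_le

theorem localSigma_le (A : Set Traj) (F : Set (ℤ × ℤ)) : localSigma A F ≤
    (inferInstance : MeasurableSpace Sample) :=
  sup_le (voidSigma_le A) (unifSigma_le F)

theorem localSigma_avoids {A K : Set Traj} (F : Set (ℤ × ℤ)) (hK : MeasurableSet K) (h : K ⊆ A) :
    MeasurableSet[localSigma A F] (avoids K) :=
  le_sup_left (a := voidSigma A) (b := unifSigma F) _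
    (MeasurableSpace.measurableSet_generateFrom ⟨K, h, hK, rfl⟩)

theorem localSigma_unif (A : Set Traj) {F : Set (ℤ × ℤ)} {x : ℤ × ℤ} (hx : x ∈ F)
    {B : Set unitInterval} (hB : MeasurableSet B) :
    MeasurableSet[localSigma A F] {s | s.2.2 x ∈ B} :=
  le_sup_right (a := voidSigma A) (b := unifSigma F) _
    (le_iSup₂ (f := fun x (_ : x ∈ F) =>
      MeasurableSpace.comap (fun s : Sample => s.2.2 x) inferInstance) x hx _ ⟨B, hB, rfl⟩)

theorem map_unifVar (M : Params) : M.prob.map (fun s => s.2.2) =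
    Measure.infinitePi fun _ : ℤ × ℤ => (volume : Measure unitInterval) := by
  unfold Params.prob
  have h : (fun s : Sample => s.2.2) = Prod.snd ∘ Prod.snd := rfl
  rw [h, ← Measure.map_map measurable_snd measurable_snd, Measure.map_snd_prod, measure_univ,
    one_smul, Measure.map_snd_prod, measure_univ, one_smul]

theorem indepFun_envVar_unifVar (M : Params) :
    IndepFun envVar (fun s : Sample => s.2.2) M.prob := by
  rw [indepFun_iff_map_prod_eq_prod_map_map measurable_envVar.aemeasurable
    measurable_unifVar.aemeasurable, map_envVar, map_unifVar]
  have h := (measurePreserving_prodAssoc (Measure.infinitePi fun _ : ℤ => poissonMeasure M.ρ)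
    (Measure.infinitePi fun _ : ℤ × ℕ × ℤ => M.stepLaw)
    (Measure.infinitePi fun _ : ℤ × ℤ => (volume : Measure unitInterval))).symm.map_eq
  exact h

/-- Void events are closed under intersection, since avoiding `K` and `L` means avoiding `K ∪ L`; so
the product formula for void events suffices. -/
theorem indep_voidSigma (M : Params) {A B : Set Traj} (hAB : Disjoint A B) :
    Indep (voidSigma A) (voidSigma B) M.prob := by
  have hpi : ∀ A, IsPiSystem {S | ∃ K, K ⊆ A ∧ MeasurableSet K ∧ S = avoids K} := by
    rintro A _ ⟨K, hKA, hK, rfl⟩ _ ⟨L, hLA, hL, rfl⟩ -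
    exact ⟨K ∪ L, Set.union_subset hKA hLA, hK.union hL, (avoids_union K L).symm⟩
  refine IndepSets.indep' ?_ ?_ (hpi A) (hpi B) ?_
  · rintro _ ⟨K, -, hK, rfl⟩; exact measurableSet_avoids hK
  · rintro _ ⟨K, -, hK, rfl⟩; exact measurableSet_avoids hK
  · rw [IndepSets_iff]
    rintro _ _ ⟨K, hKA, hK, rfl⟩ ⟨L, hLB, hL, rfl⟩
    exact prob_avoids_inter M hK hL (hAB.mono hKA hLB)

theorem indep_unifSigma (M : Params) {F G : Set (ℤ × ℤ)} (hFG : Disjoint F G) :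
    Indep (unifSigma F) (unifSigma G) M.prob := by
  refine indep_iSup_of_disjoint (fun x => (measurable_unifVar_apply x).comap_le) ?_ hFG
  have h : iIndepFun (fun x (s : Sample) => s.2.2 x) M.prob := by
    rw [iIndepFun_iff_map_fun_eq_infinitePi_map measurable_unifVar_apply]
    refine (map_unifVar M).trans ?_
    congr 1
    funext x
    rw [show (fun s : Sample => s.2.2 x) = (fun f => f x) ∘ fun s : Sample => s.2.2 from rfl,
      ← Measure.map_map (measurable_pi_apply x) measurable_unifVar, map_unifVar]
    exact (Measure.infinitePi_map_eval (fun _ : ℤ × ℤ => (volume : Measure unitInterval)) x).symm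
  exact h

theorem indep_localSigma (M : Params) {A B : Set Traj} {F G : Set (ℤ × ℤ)} (hAB : Disjoint A B)
    (hFG : Disjoint F G) : Indep (localSigma A F) (localSigma B G) M.prob := by
  refine indep_sup_sup (voidSigma_le A) (voidSigma_le B) (unifSigma_le F) (unifSigma_le G) ?_
    (indep_voidSigma M hAB) (indep_unifSigma M hFG)
  have h := (IndepFun_iff_Indep _ _ _).1 (indepFun_envVar_unifVar M)
  exact indep_of_indep_of_le_left (indep_of_indep_of_le_right h
    (sup_le (unifSigma_le_unifVar F) (unifSigma_le_unifVar G)))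
    (sup_le (voidSigma_le_envVar A) (voidSigma_le_envVar B))

/-! ### Stationarity of the environment -/

/-- The events "all indicators in `F` hold" form a generating π-system. For void indicators they are
again void events, whose probabilities are known. -/
theorem measure_pi_prop_ext {ι : Type*} {μ ν : Measure (ι → Prop)} [IsProbabilityMeasure μ]
    [IsProbabilityMeasure ν]
    (h : ∀ F : Finset ι, μ {f | ∀ i ∈ F, f i} = ν {f | ∀ i ∈ F, f i}) : μ = ν := by
  classical
  refine ext_of_generate_finite (Set.range fun F : Finset ι => {f : ι → Prop | ∀ i ∈ F, f i})
    (le_antisymm ?_ ?_) ?_ ?_ (by simp)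
  · refine iSup_le fun i => ?_
    rw [← measurable_iff_comap_le]
    refine (@measurableSet_setOfPred _ (MeasurableSpace.generateFrom _) _).1
      (MeasurableSpace.measurableSet_generateFrom ⟨{i}, ?_⟩)
    simp
  · refine MeasurableSpace.generateFrom_le ?_
    rintro _ ⟨F, rfl⟩
    have : {f : ι → Prop | ∀ i ∈ F, f i} = ⋂ i ∈ F, {f | f i} := by ext; simp
    dsimp only
    rw [this]
    exact F.measurableSet_biInter fun i _ => measurableSet_setOfPred.2 (measurable_pi_apply i)
  · rintro _ ⟨F, rfl⟩ _ ⟨G, rfl⟩ -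
    refine ⟨F ∪ G, ?_⟩
    ext f
    simp only [Finset.mem_union, Set.mem_ofPred_eq, Set.mem_inter_iff]
    exact ⟨fun h => ⟨fun i hi => h i (.inl hi), fun i hi => h i (.inr hi)⟩,
      fun h i hi => hi.elim (h.1 i) (h.2 i)⟩
  · rintro _ ⟨F, rfl⟩
    exact h F

/-- The void indicators of the sets `K j` seen from `y`. -/
def voidInd {ι : Type*} (K : ι → Set Traj) (y : ℤ × ℤ) (s : Sample) (j : ι) : Prop :=
  s ∈ avoids (shiftTraj y ⁻¹' K j)

/-- The variables `U` seen from `y`. -/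
def unifFrom (y : ℤ × ℤ) (s : Sample) (x : ℤ × ℤ) : unitInterval := s.2.2 (x + y)

theorem measurable_voidInd {ι : Type*} {K : ι → Set Traj} (hK : ∀ j, MeasurableSet (K j))
    (y : ℤ × ℤ) : Measurable (voidInd K y) :=
  measurable_pi_lambda _ fun j =>
    measurableSet_setOfPred.1 (measurableSet_avoids (measurable_shiftTraj y (hK j)))

theorem measurable_unifFrom (y : ℤ × ℤ) : Measurable (unifFrom y) :=
  measurable_pi_lambda _ fun x => measurable_unifVar_apply (x + y)

theorem map_voidInd {ι : Type*} (M : Params) {K : ι → Set Traj} (hK : ∀ j, MeasurableSet (K j))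
    (y y' : ℤ × ℤ) : M.prob.map (voidInd K y) = M.prob.map (voidInd K y') := by
  have hm := measurable_voidInd hK
  have := fun y => Measure.isProbabilityMeasure_map (μ := M.prob) (hm y).aemeasurable
  refine measure_pi_prop_ext fun F => ?_
  have hF : MeasurableSet {f : ι → Prop | ∀ i ∈ F, f i} := by
    have : {f : ι → Prop | ∀ i ∈ F, f i} = ⋂ i ∈ F, {f | f i} := by ext; simp
    rw [this]
    exact F.measurableSet_biInter fun i _ => measurableSet_setOfPred.2 (measurable_pi_apply i)
  have key : ∀ y, voidInd K y ⁻¹' {f | ∀ i ∈ F, f i}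
      = avoids (shiftTraj y ⁻¹' ⋃ i ∈ F, K i) := by
    intro y
    ext s
    simp only [Set.preimage_iUnion, avoids_iUnion, voidInd, Set.mem_preimage, Set.mem_ofPred_eq,
      Set.mem_iInter]
  rw [Measure.map_apply (hm y) hF, Measure.map_apply (hm y') hF, key, key,
    prob_avoids_shift M y (F.measurableSet_biUnion fun i _ => hK i),
    prob_avoids_shift M y' (F.measurableSet_biUnion fun i _ => hK i)]

theorem map_unifFrom (M : Params) (y : ℤ × ℤ) : M.prob.map (unifFrom y) =
    Measure.infinitePi fun _ : ℤ × ℤ => (volume : Measure unitInterval) := by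
  rw [show unifFrom y = (fun f x => f (x + y)) ∘ fun s : Sample => s.2.2 from rfl,
    ← Measure.map_map (by fun_prop) measurable_unifVar, map_unifVar]
  exact Measure.map_infinitePi_infinitePi_of_inj (f := fun x : ℤ × ℤ => x + y)
    (P := fun _ : ℤ × ℤ => (volume : Measure unitInterval)) (add_left_injective y)

theorem map_voidInd_unifFrom {ι : Type*} (M : Params) {K : ι → Set Traj}
    (hK : ∀ j, MeasurableSet (K j)) (y y' : ℤ × ℤ) :
    M.prob.map (fun s => (voidInd K y s, unifFrom y s))
      = M.prob.map (fun s => (voidInd K y' s, unifFrom y' s)) := by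
  have h : ∀ y, M.prob.map (fun s => (voidInd K y s, unifFrom y s))
      = (M.prob.map (voidInd K y)).prod (M.prob.map (unifFrom y)) := by
    intro y
    refine IndepFun.map_prod_eq_prod_map_map (measurable_voidInd hK y).aemeasurable
      (measurable_unifFrom y).aemeasurable ?_
    refine indep_of_indep_of_le_left (indep_of_indep_of_le_right (indepFun_envVar_unifVar M) ?_) ?_
    · have : Measurable fun (f : ℤ × ℤ → unitInterval) x => f (x + y) := by fun_prop
      rintro _ ⟨B, hB, rfl⟩
      exact ⟨_, this hB, rfl⟩
    · have : Measurable fun (e : (ℤ → ℕ) × ((ℤ × ℕ × ℤ) → Step)) (j : ι) =>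
          e ∈ avoidsOn Set.univ (shiftTraj y ⁻¹' K j) :=
        measurable_pi_lambda _ fun j =>
          measurableSet_setOfPred.1 (measurableSet_avoidsOn _ (measurable_shiftTraj y (hK j)))
      rintro _ ⟨B, hB, rfl⟩
      refine ⟨_, this hB, ?_⟩
      ext s
      simp only [Set.mem_preimage]
      have : voidInd K y s = fun j => envVar s ∈ avoidsOn Set.univ (shiftTraj y ⁻¹' K j) := by
        funext j
        rw [voidInd, avoids_eq_preimage]
        rfl
      rw [this]
  rw [h, h, map_voidInd M hK y y', map_unifFrom, map_unifFrom]

/-! ### Deterministic walks -/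

open Classical in
/-- The walk started at `y` that jumps to the right exactly at the points satisfying `b`. -/
noncomputable def detWalk (b : ℤ × ℤ → Prop) (y : ℤ × ℤ) : ℕ → ℤ × ℤ
  | 0 => y
  | n + 1 => if b (detWalk b y n) then detWalk b y n + (1, 1) else detWalk b y n + (-1, 1)

/-- The condition for a jump to the right from a point with occupation status `T` and uniform
variable `u`. -/
def Params.jumpRight (M : Params) (T : Prop) (u : unitInterval) : Prop :=
  (T ∧ (u : ℝ) ≤ M.pOcc) ∨ (¬T ∧ (u : ℝ) ≤ M.pVac)

/-- The space-time points from which the walk jumps to the right. -/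
def Params.rightAt (M : Params) (s : Sample) (x : ℤ × ℤ) : Prop :=
  M.jumpRight (s ∉ avoids (through x)) (s.2.2 x)

theorem Params.walk_eq (M : Params) (s : Sample) (y : ℤ × ℤ) (n : ℕ) :
    M.walk s y n = detWalk (M.rightAt s) y n := by
  induction n with
  | zero => rfl
  | succ n ih =>
    rw [Params.walk, detWalk, ← ih]
    have h : ((M.walk s y n ∈ totalTrace s ∧ unif s (M.walk s y n) ≤ M.pOcc) ∨
        (M.walk s y n ∉ totalTrace s ∧ unif s (M.walk s y n) ≤ M.pVac)) ↔
        M.rightAt s (M.walk s y n) := by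
      rw [mem_totalTrace_iff]; rfl
    by_cases hb : M.rightAt s (M.walk s y n)
    · rw [if_pos hb]; exact if_pos (h.2 hb)
    · rw [if_neg hb]; exact if_neg fun hc => hb (h.1 hc)

theorem detWalk_snd (b : ℤ × ℤ → Prop) (y : ℤ × ℤ) (n : ℕ) : (detWalk b y n).2 = y.2 + n := by
  induction n with
  | zero => simp [detWalk]
  | succ n ih =>
    rw [detWalk]
    split_ifs <;> simp [ih, add_assoc]

theorem detWalk_add (b : ℤ × ℤ → Prop) (y : ℤ × ℤ) (m n : ℕ) :
    detWalk b y (m + n) = detWalk b (detWalk b y m) n := by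
  induction n with
  | zero => rfl
  | succ n ih => rw [← add_assoc, detWalk, detWalk, ih]

theorem detWalk_sub (b : ℤ × ℤ → Prop) (y : ℤ × ℤ) (n : ℕ) :
    detWalk b y n - y = detWalk (fun x => b (x + y)) 0 n := by
  induction n with
  | zero => simp [detWalk]
  | succ n ih =>
    rw [detWalk, detWalk, ← ih, sub_add_cancel]
    split_ifs <;> abel

/-- Agreement is needed only along the trajectory of one walk; this localises the dependence on the
environment. -/
theorem detWalk_congr {b b' : ℤ × ℤ → Prop} {y : ℤ × ℤ} {n : ℕ}
    (h : ∀ i < n, (b (detWalk b y i) ↔ b' (detWalk b y i))) :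
    ∀ i ≤ n, detWalk b y i = detWalk b' y i := by
  intro i hi
  induction i with
  | zero => rfl
  | succ i ih =>
    have h1 := ih (by omega)
    have h2 := propext (h i (by omega))
    rw [detWalk, detWalk, ← h1, h2]

theorem measurable_detWalk (y : ℤ × ℤ) (n : ℕ) :
    Measurable fun b : ℤ × ℤ → Prop => detWalk b y n := by
  classical
  induction n with
  | zero => exact measurable_const
  | succ n ih =>
    have h : MeasurableSet {b : ℤ × ℤ → Prop | b (detWalk b y n)} := by
      have : {b : ℤ × ℤ → Prop | b (detWalk b y n)}
          = ⋃ z, (fun b => detWalk b y n) ⁻¹' {z} ∩ {b | b z} := by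
        ext b; simp
      rw [this]
      exact MeasurableSet.iUnion fun z => (ih (measurableSet_singleton z)).inter
        (measurableSet_setOfPred.2 (measurable_pi_apply z))
    simp only [detWalk]
    exact Measurable.ite h (ih.add_const _) (ih.add_const _)

theorem measurable_detWalk_path (y : ℤ × ℤ) :
    Measurable fun b : ℤ × ℤ → Prop => detWalk b y :=
  measurable_pi_lambda _ fun n => measurable_detWalk y n

/-! ### The event that a regeneration with prescribed future occurs at `y` -/

/-- The event that the regeneration condition holds at `y` and that the walk started at `y` has
increments in `D`. -/
def Params.goodFuture (M : Params) (vbar : ℝ) (y : ℤ × ℤ) (D : Set (ℕ → ℤ × ℤ)) : Set Sample :=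
  M.good vbar y ∩ {s | (fun i => M.walk s y i - y) ∈ D}

theorem Params.mem_good_iff (M : Params) (vbar : ℝ) (y : ℤ × ℤ) (s : Sample) :
    s ∈ M.good vbar y ↔ s ∈ avoids (crossing vbar y) ∧
      ∀ i, detWalk (M.rightAt s) y i ∈ cone vbar y := by
  simp only [Params.good, Params.stays, Set.mem_inter_iff, Set.mem_ofPred_eq,
    pointProcess_eq_zero_iff (measurableSet_crossing vbar y), Params.walk_eq]

theorem measurableSet_jumpRight (M : Params) {Ω : Type*} [MeasurableSpace Ω] {S : Set Ω}
    {u : Ω → unitInterval} (hS : MeasurableSet S)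
    (hu : ∀ B : Set unitInterval, MeasurableSet B → MeasurableSet {s | u s ∈ B}) :
    MeasurableSet {s | M.jumpRight (s ∉ S) (u s)} := by
  have h : ∀ a : ℝ, MeasurableSet {s | (u s : ℝ) ≤ a} := fun a =>
    hu {v | (v : ℝ) ≤ a} (measurableSet_le measurable_subtype_coe measurable_const)
  have : {s | M.jumpRight (s ∉ S) (u s)}
      = (Sᶜ ∩ {s | (u s : ℝ) ≤ M.pOcc}) ∪ (S ∩ {s | (u s : ℝ) ≤ M.pVac}) := by
    ext s
    simp [Params.jumpRight]
  rw [this]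
  exact (hS.compl.inter (h _)).union (hS.inter (h _))

theorem measurable_rightAt (M : Params) : Measurable M.rightAt :=
  measurable_pi_lambda _ fun x => measurableSet_setOfPred.1 <|
    measurableSet_jumpRight M (measurableSet_avoids (measurableSet_through x))
      fun _ hB => measurable_unifVar_apply x hB

theorem through_subset_meets {S : Set (ℤ × ℤ)} {x : ℤ × ℤ} (hx : x ∈ S) :
    through x ⊆ meets S := Set.subset_biUnion_of_mem (u := through) hx

theorem meets_mono {S T : Set (ℤ × ℤ)} (h : S ⊆ T) : meets S ⊆ meets T :=
  Set.biUnion_subset_biUnion_left h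

theorem localSigma_goodFuture (M : Params) (vbar : ℝ) (y : ℤ × ℤ) {D : Set (ℕ → ℤ × ℤ)}
    (hD : MeasurableSet D) :
    MeasurableSet[localSigma (meets (cone vbar y)) (cone vbar y)] (M.goodFuture vbar y D) := by
  set m := localSigma (meets (cone vbar y)) (cone vbar y)
  -- Jump rule truncated to the cone, hence locally measurable. A walk that stays in the cone under
  -- either rule follows the same path under the other.
  let b : Sample → ℤ × ℤ → Prop := fun s x => x ∈ cone vbar y ∧ M.rightAt s x
  have hb : Measurable[m] b := by
    refine @measurable_pi_lambda _ _ _ m _ _ fun x => ?_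
    by_cases hx : x ∈ cone vbar y
    · have : (fun s => b s x) = fun s => M.rightAt s x := by
        funext s; simp [b, hx]
      rw [this]
      exact (@measurableSet_setOfPred _ m _).1 (@measurableSet_jumpRight M _ m _ _
        (localSigma_avoids _ (measurableSet_through x) (through_subset_meets hx))
        fun B hB => localSigma_unif _ hx hB)
    · have : (fun s => b s x) = fun _ => False := by
        funext s; simp [b, hx]
      rw [this]
      exact @measurable_const _ _ _ m _
  have key : ∀ s, (∀ i, detWalk (M.rightAt s) y i ∈ cone vbar y) ↔
      ∀ i, detWalk (b s) y i ∈ cone vbar y := by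
    intro s
    constructor
    · intro h i
      rw [← detWalk_congr (b := M.rightAt s) (b' := b s) (n := i)
        (fun j _ => by simp [b, h j]) i le_rfl]
      exact h i
    · intro h i
      rw [← detWalk_congr (b := b s) (b' := M.rightAt s) (n := i)
        (fun j _ => by simp [b, h j]) i le_rfl]
      exact h i
  have heq : M.goodFuture vbar y D = avoids (crossing vbar y) ∩
      (b ⁻¹' {b | (∀ i, detWalk b y i ∈ cone vbar y) ∧ (fun i => detWalk b y i - y) ∈ D}) := by
    ext s
    simp only [Params.goodFuture, Set.mem_inter_iff, Params.mem_good_iff, Set.mem_ofPred_eq,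
      Params.walk_eq, Set.mem_preimage, ← key s, and_assoc]
    refine and_congr_right fun _ => and_congr_right fun h => ?_
    have : ∀ i, detWalk (M.rightAt s) y i = detWalk (b s) y i := fun i =>
      detWalk_congr (b := M.rightAt s) (b' := b s) (n := i) (fun j _ => by simp [b, h j]) i le_rfl
    simp only [this]
  rw [heq]
  refine @MeasurableSet.inter _ m _ _ (localSigma_avoids _ (measurableSet_crossing vbar y) ?_)
    (hb ?_)
  · rw [crossing_eq]; exact Set.inter_subset_left
  · refine MeasurableSet.inter ?_ ?_
    · have : {b : ℤ × ℤ → Prop | ∀ i, detWalk b y i ∈ cone vbar y}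
          = ⋂ i, (fun b => detWalk b y i) ⁻¹' cone vbar y := by ext; simp
      rw [show (fun b : ℤ × ℤ → Prop => ∀ i, detWalk b y i ∈ cone vbar y) =
        {b : ℤ × ℤ → Prop | ∀ i, detWalk b y i ∈ cone vbar y} from rfl, this]
      exact MeasurableSet.iInter fun i => measurable_detWalk y i (Set.to_countable _).measurableSet
    · exact (measurable_pi_lambda _ fun i => (measurable_detWalk y i).sub_const y :
        Measurable fun (b : ℤ × ℤ → Prop) (i : ℕ) => detWalk b y i - y) hD

/-- The sets of trajectories on which the regeneration event at the origin depends. -/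
def regSets (vbar : ℝ) : Option (ℤ × ℤ) → Set Traj
  | none => crossing vbar 0
  | some x => through x

/-- The event at `y` is the preimage of one fixed set `B` under the void indicators and uniforms
seen from `y`, whose joint law does not depend on `y`. -/
theorem prob_goodFuture (M : Params) (vbar : ℝ) (y : ℤ × ℤ) {D : Set (ℕ → ℤ × ℤ)}
    (hD : MeasurableSet D) :
    M.prob (M.goodFuture vbar y D) = M.prob (M.goodFuture vbar 0 D) := by
  have hK : ∀ j, MeasurableSet (regSets vbar j) := by
    rintro (_ | x)
    · exact measurableSet_crossing vbar 0
    · exact measurableSet_through x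
  let r : (Option (ℤ × ℤ) → Prop) × (ℤ × ℤ → unitInterval) → ℤ × ℤ → Prop :=
    fun p x => M.jumpRight (¬ p.1 (some x)) (p.2 x)
  have hr : Measurable r := by
    refine measurable_pi_lambda _ fun x => measurableSet_setOfPred.1 ?_
    refine measurableSet_jumpRight M
      (S := {p : (Option (ℤ × ℤ) → Prop) × (ℤ × ℤ → unitInterval) | p.1 (some x)})
      (u := fun p => p.2 x) ?_
      fun B hB => ?_
    · exact measurableSet_setOfPred.2 ((measurable_pi_apply (some x)).comp measurable_fst)
    · exact ((measurable_pi_apply x).comp measurable_snd) hB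
  let B : Set ((Option (ℤ × ℤ) → Prop) × (ℤ × ℤ → unitInterval)) :=
    {p | p.1 none} ∩ ((⋂ i, (fun p => detWalk (r p) 0 i) ⁻¹' cone vbar 0) ∩
      (fun p => detWalk (r p) 0) ⁻¹' D)
  have hB : MeasurableSet B := by
    refine MeasurableSet.inter ?_ (MeasurableSet.inter ?_ ?_)
    · exact measurableSet_setOfPred.2 ((measurable_pi_apply none).comp measurable_fst)
    · exact MeasurableSet.iInter fun i =>
        ((measurable_detWalk 0 i).comp hr) (Set.to_countable _).measurableSet
    · exact ((measurable_detWalk_path 0).comp hr) hD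
  have key : ∀ y, M.goodFuture vbar y D
      = (fun s => (voidInd (regSets vbar) y s, unifFrom y s)) ⁻¹' B := by
    intro y
    ext s
    have h1 : ∀ n, detWalk (M.rightAt s) y n - y
        = detWalk (r (voidInd (regSets vbar) y s, unifFrom y s)) 0 n := by
      intro n
      rw [detWalk_sub]
      congr 1
      funext x
      simp only [r, voidInd, regSets, unifFrom, Params.rightAt, shiftTraj_preimage_through]
    have h2 : ∀ n, detWalk (M.rightAt s) y n ∈ cone vbar y ↔
        detWalk (r (voidInd (regSets vbar) y s, unifFrom y s)) 0 n ∈ cone vbar 0 := by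
      intro n
      rw [← h1, add_mem_cone_iff vbar _ y, sub_add_cancel]
    simp only [Params.goodFuture, Set.mem_inter_iff, Params.mem_good_iff, Set.mem_ofPred_eq,
      Params.walk_eq, h1, h2, Set.mem_preimage, B, Set.mem_iInter, and_assoc]
    simp only [voidInd, regSets, shiftTraj_preimage_crossing]
  have hm : ∀ y, Measurable fun s => (voidInd (regSets vbar) y s, unifFrom y s) := fun y =>
    (measurable_voidInd hK y).prodMk (measurable_unifFrom y)
  rw [key, key, ← Measure.map_apply (hm y) hB, ← Measure.map_apply (hm 0) hB,
    map_voidInd_unifFrom M hK y 0]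

/-! ### Records -/

theorem sInf_coe_image_eq_iff (S : Set ℕ) (m : ℕ) :
    sInf ((fun n : ℕ => (n : ℕ∞)) '' S) = m ↔ m ∈ S ∧ ∀ i ∈ S, m ≤ i := by
  constructor
  · intro h
    have hne : S.Nonempty := by
      by_contra hS
      rw [Set.not_nonempty_iff_eq_empty] at hS
      simp [hS] at h
    have hmem := csInf_mem (hne.image fun n : ℕ => (n : ℕ∞))
    rw [h] at hmem
    obtain ⟨n, hn, hnm⟩ := hmem
    have : n = m := Nat.cast_injective hnm
    refine ⟨this ▸ hn, fun i hi => ?_⟩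
    have := sInf_le (Set.mem_image_of_mem (fun n : ℕ => (n : ℕ∞)) hi)
    rw [h] at this
    exact_mod_cast this
  · rintro ⟨hm, hle⟩
    apply le_antisymm
    · exact sInf_le ⟨m, hm, rfl⟩
    · refine le_sInf ?_
      rintro _ ⟨i, hi, rfl⟩
      exact Nat.cast_le.2 (hle i hi)

/-- The `k`-th record time of a path. -/
noncomputable def pathRecord (vbar : ℝ) (f : ℕ → ℤ × ℤ) (k : ℕ) : ℕ∞ :=
  sInf ((fun n : ℕ => (n : ℕ∞)) '' {n | (1 - vbar) * k + vbar * n ≤ (f n).1})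

theorem pathRecord_eq_iff {vbar : ℝ} {f : ℕ → ℤ × ℤ} {k m : ℕ} :
    pathRecord vbar f k = m ↔ (1 - vbar) * k + vbar * m ≤ (f m).1 ∧
      ∀ i < m, ((f i).1 : ℝ) < (1 - vbar) * k + vbar * i := by
  rw [pathRecord, sInf_coe_image_eq_iff]
  refine and_congr_right fun _ => forall_congr' fun i => ?_
  simp only [Set.mem_ofPred_eq]
  constructor
  · intro h hi; by_contra! hc; exact absurd (h hc) (by omega)
  · intro h hi; by_contra! hc; exact absurd (h hc) (by linarith)

theorem pathRecord_congr {vbar : ℝ} {f g : ℕ → ℤ × ℤ} {n m k : ℕ} (h : ∀ i ≤ n, f i = g i)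
    (hm : m ≤ n) (hf : pathRecord vbar f k = m) : pathRecord vbar g k = m := by
  rw [pathRecord_eq_iff] at hf ⊢
  rw [← h m hm]
  exact ⟨hf.1, fun i hi => by rw [← h i (by omega)]; exact hf.2 i hi⟩

/-- The record line is nondecreasing in its index because `1 - vbar ≥ 0`, so lower lines have been
reached by time `n`. -/
theorem exists_pathRecord_eq {vbar : ℝ} (hv : vbar ≤ 1) {f : ℕ → ℤ × ℤ} {j k n : ℕ} (hjk : j ≤ k)
    (h : pathRecord vbar f k = n) : ∃ m ≤ n, pathRecord vbar f j = m := by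
  have h1 : pathRecord vbar f j ≤ n := by
    refine sInf_le ⟨n, ?_, rfl⟩
    have h2 := (pathRecord_eq_iff.1 h).1
    have h3 : (1 - vbar) * (j : ℝ) ≤ (1 - vbar) * k :=
      mul_le_mul_of_nonneg_left (by exact_mod_cast hjk) (by linarith)
    simp only [Set.mem_ofPred_eq]
    linarith
  obtain ⟨m, hm⟩ := ENat.ne_top_iff_exists.1 (ne_top_of_le_ne_top (ENat.natCast_ne_top n) h1)
  rw [← hm] at h1
  exact ⟨m, by exact_mod_cast h1, hm.symm⟩

/-- Before time `n` the path is strictly below a line of slope `vbar`, and at time `n` it is on or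
above it; subtract. -/
theorem mem_backCone_of_pathRecord_eq {vbar : ℝ} (hv : 0 ≤ vbar) {f : ℕ → ℤ × ℤ} {k n i : ℕ}
    (h : pathRecord vbar f k = n) (hi : i < n) (h2 : ∀ j ≤ n, (f j).2 = j) :
    f i ∈ backCone vbar (f n) := by
  rw [pathRecord_eq_iff] at h
  have h3 := h.2 i hi
  have h4 := h2 i hi.le
  have h5 := h2 n le_rfl
  have h6 : ((f i).1 : ℝ) - (f n).1 < vbar * ((i : ℝ) - n) := by
    rw [mul_sub]; linarith [h.1]
  have h7 : (i : ℝ) - n ≤ 0 := by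
    have : (i : ℝ) ≤ n := by exact_mod_cast hi.le
    linarith
  have h8 : ((f i).1 : ℝ) ≤ (f n).1 := by nlinarith
  refine ⟨?_, ?_, ?_⟩
  · have : (f i).1 ≤ (f n).1 := by exact_mod_cast h8
    omega
  · rw [h4, h5]; omega
  · rw [h4, h5]; push_cast; exact h6

/-! ### Geometry of the cones -/

theorem cone_trans {vbar : ℝ} {x y z : ℤ × ℤ} (hy : y ∈ cone vbar z) (hx : x ∈ cone vbar y) :
    x ∈ cone vbar z := by
  obtain ⟨a1, a2, a3⟩ := hy
  obtain ⟨b1, b2, b3⟩ := hx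
  refine ⟨by omega, by omega, ?_⟩
  push_cast at *
  nlinarith

theorem backCone_subset {vbar : ℝ} {y z : ℤ × ℤ} (hy : y ∈ cone vbar z) :
    backCone vbar z ⊆ backCone vbar y := by
  intro x hx
  obtain ⟨a1, a2, a3⟩ := hy
  obtain ⟨b1, b2, b3⟩ := hx
  refine ⟨by omega, by omega, ?_⟩
  push_cast at *
  nlinarith

/-- The strict inequality in the back cone assigns the apex, and so its uniform variable, to the
future. -/
theorem disjoint_cone_backCone (vbar : ℝ) (y : ℤ × ℤ) :
    Disjoint (backCone vbar y) (cone vbar y) := by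
  rw [Set.disjoint_left]
  rintro x ⟨a1, a2, a3⟩ ⟨b1, b2, b3⟩
  exact absurd a3 (not_lt.2 b3)

/-- The decoupling device: when nothing crosses at `y`, trajectories of `K` that meet the cone at
`y` are already excluded, so they may be dropped from `K`. -/
theorem mem_avoids_iff_diff {vbar : ℝ} {y : ℤ × ℤ} {s : Sample} {K : Set Traj}
    (hs : s ∈ avoids (crossing vbar y)) (hK : K ∩ meets (cone vbar y) ⊆ crossing vbar y) :
    s ∈ avoids K ↔ s ∈ avoids (K \ meets (cone vbar y)) := by
  refine ⟨fun h => avoids_anti Set.sdiff_subset h, fun h => ?_⟩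
  have : s ∈ avoids (K \ meets (cone vbar y) ∪ crossing vbar y) := by
    rw [avoids_union]; exact ⟨h, hs⟩
  refine avoids_anti (fun w hw => ?_) this
  by_cases hc : w ∈ meets (cone vbar y)
  · exact .inr (hK ⟨hw, hc⟩)
  · exact .inl ⟨hw, hc⟩

/-! ### The event of a prescribed past, in terms of the environment behind the regeneration -/

/-- The jumps to the right in the third-quadrant cone at `y`, computed from the trajectories that
do not meet the first-quadrant cone at `y`. -/
def Params.rightBehind (M : Params) (vbar : ℝ) (y : ℤ × ℤ) (s : Sample) (x : ℤ × ℤ) : Prop :=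
  x ∈ backCone vbar y ∧
    M.jumpRight (s ∉ avoids (through x \ meets (cone vbar y))) (s.2.2 x)

/-- The event that the regeneration condition at `f m` is not violated by the path up to time `n`
nor by trajectories that do not meet the cone at `f n`. -/
def goodBehind (vbar : ℝ) (f : ℕ → ℤ × ℤ) (n m : ℕ) : Set Sample :=
  avoids (crossing vbar (f m) \ meets (cone vbar (f n))) ∩
    {_s | ∀ i, m ≤ i → i ≤ n → f i ∈ cone vbar (f m)}

/-- The event of a prescribed path up to time `n`, computed behind the cone at `f n`. -/
def Params.pathBehind (M : Params) (vbar : ℝ) (f : ℕ → ℤ × ℤ) (n : ℕ) : Set Sample :=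
  {s | ∀ i ≤ n, detWalk (M.rightBehind vbar (f n) s) 0 i = f i}

/-- The event of a prescribed past `(n, f)`, computed behind the cone at `f n`. -/
def Params.pastBehind (M : Params) (vbar : ℝ) (f : ℕ → ℤ × ℤ) (n : ℕ) : Set Sample :=
  M.pathBehind vbar f n ∩
    ⋃ k ∈ {k : ℕ | 1 ≤ k ∧ pathRecord vbar f k = n},
      ⋂ j ∈ {j : ℕ | 1 ≤ j ∧ j < k}, (goodBehind vbar f n (pathRecord vbar f j).toNat)ᶜ

theorem mem_avoids_through_iff {vbar : ℝ} {y x : ℤ × ℤ} {s : Sample}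
    (hs : s ∈ avoids (crossing vbar y)) (hx : x ∈ backCone vbar y) :
    s ∈ avoids (through x) ↔ s ∈ avoids (through x \ meets (cone vbar y)) := by
  refine mem_avoids_iff_diff hs fun w hw => ?_
  rw [crossing_eq]
  exact ⟨hw.2, through_subset_meets hx hw.1⟩

theorem mem_avoids_crossing_iff {vbar : ℝ} {y z : ℤ × ℤ} {s : Sample}
    (hs : s ∈ avoids (crossing vbar y)) (hy : y ∈ cone vbar z) :
    s ∈ avoids (crossing vbar z) ↔ s ∈ avoids (crossing vbar z \ meets (cone vbar y)) := by
  refine mem_avoids_iff_diff hs fun w hw => ?_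
  rw [crossing_eq] at hw ⊢
  exact ⟨hw.2, meets_mono (backCone_subset hy) hw.1.2⟩

theorem Params.rightBehind_iff (M : Params) {vbar : ℝ} {y x : ℤ × ℤ} {s : Sample}
    (hs : s ∈ avoids (crossing vbar y)) (hx : x ∈ backCone vbar y) :
    M.rightBehind vbar y s x ↔ M.rightAt s x := by
  rw [Params.rightBehind, Params.rightAt, mem_avoids_through_iff hs hx]
  simp [hx]

/-- A walk following `f` up to the record time `n` only uses jump rules in the back cone, where the
true rule and the rule behind `f n` coincide. -/
theorem Params.mem_pathBehind_iff (M : Params) {vbar : ℝ} (hv : 0 ≤ vbar) {f : ℕ → ℤ × ℤ} {n k : ℕ}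
    (hk : pathRecord vbar f k = n) {s : Sample} (hs : s ∈ avoids (crossing vbar (f n))) :
    s ∈ M.pathBehind vbar f n ↔ ∀ i ≤ n, M.Y s i = f i := by
  simp only [Params.pathBehind, Set.mem_ofPred_eq, Params.Y, Params.walk_eq]
  have hb : ∀ b : ℤ × ℤ → Prop, (∀ i ≤ n, detWalk b 0 i = f i) →
      ∀ i < n, f i ∈ backCone vbar (f n) := fun b h i hi =>
    mem_backCone_of_pathRecord_eq hv hk hi fun j hj => by rw [← h j hj, detWalk_snd]; simp
  constructor
  · intro h i hi
    rw [← h i hi]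
    refine (detWalk_congr (n := n) (fun j hj => ?_) i hi).symm
    rw [h j hj.le]
    exact M.rightBehind_iff hs (hb _ h j hj)
  · intro h i hi
    rw [← h i hi]
    refine (detWalk_congr (n := n) (fun j hj => ?_) i hi).symm
    rw [h j hj.le]
    exact (M.rightBehind_iff hs (hb _ h j hj)).symm

/-- If the path stays in the cone of `f m` up to time `n`, that cone contains the cone of `f n`. So
the later path stays in it automatically, and any crossing at `f m` that meets the cone of `f n` is
a crossing at `f n`. -/
theorem Params.mem_good_iff_goodBehind (M : Params) {vbar : ℝ} {f : ℕ → ℤ × ℤ} {n m : ℕ}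
    {s : Sample} (hs : s ∈ M.good vbar (f n)) (hf : ∀ i ≤ n, M.Y s i = f i) (hm : m ≤ n) :
    s ∈ M.good vbar (f m) ↔ s ∈ goodBehind vbar f n m := by
  rw [Params.mem_good_iff] at hs ⊢
  simp only [Params.Y, Params.walk_eq] at hf
  have hsh : ∀ i, detWalk (M.rightAt s) (f m) i = detWalk (M.rightAt s) 0 (m + i) := by
    intro i
    rw [detWalk_add, hf m hm]
  have hn : ∀ i, detWalk (M.rightAt s) (f n) i = detWalk (M.rightAt s) 0 (n + i) := by
    intro i
    rw [detWalk_add, hf n le_rfl]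
  simp only [goodBehind, Set.mem_inter_iff, Set.mem_ofPred_eq]
  constructor
  · rintro ⟨h1, h2⟩
    refine ⟨avoids_anti Set.sdiff_subset h1, fun i hmi hin => ?_⟩
    have := h2 (i - m)
    rwa [hsh, Nat.add_sub_cancel' hmi, hf i hin] at this
  · rintro ⟨h1, h2⟩
    have hy := h2 n hm le_rfl
    refine ⟨(mem_avoids_crossing_iff hs.1 hy).2 h1, fun i => ?_⟩
    rw [hsh]
    rcases le_total (m + i) n with h | h
    · rw [hf _ h]
      exact h2 _ (by omega) h
    · have := cone_trans hy (hs.2 (m + i - n))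
      rwa [hn, Nat.add_sub_cancel' h] at this

theorem localSigma_goodBehind (vbar : ℝ) (f : ℕ → ℤ × ℤ) (n m : ℕ) (F : Set (ℤ × ℤ)) :
    MeasurableSet[localSigma (meets (cone vbar (f n)))ᶜ F] (goodBehind vbar f n m) := by
  refine @MeasurableSet.inter _ (localSigma _ _) _ _ (localSigma_avoids _
    ((measurableSet_crossing _ _).diff (measurableSet_meets _)) fun w hw => hw.2) ?_
  exact @MeasurableSet.const _ (localSigma _ _) _

theorem localSigma_pathBehind (M : Params) (vbar : ℝ) (f : ℕ → ℤ × ℤ) (n : ℕ) :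
    MeasurableSet[localSigma (meets (cone vbar (f n)))ᶜ (backCone vbar (f n))]
      (M.pathBehind vbar f n) := by
  set m := localSigma (meets (cone vbar (f n)))ᶜ (backCone vbar (f n))
  have hb : Measurable[m] (M.rightBehind vbar (f n)) := by
    refine @measurable_pi_lambda _ _ _ m _ _ fun x => ?_
    by_cases hx : x ∈ backCone vbar (f n)
    · have : (fun s => M.rightBehind vbar (f n) s x) = fun s =>
          M.jumpRight (s ∉ avoids (through x \ meets (cone vbar (f n)))) (s.2.2 x) := by
        funext s; simp [Params.rightBehind, hx]
      rw [this]
      exact (@measurableSet_setOfPred _ m _).1 (@measurableSet_jumpRight M _ m _ _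
        (localSigma_avoids _ ((measurableSet_through x).diff (measurableSet_meets _))
          fun w hw => hw.2)
        fun B hB => localSigma_unif _ hx hB)
    · have : (fun s => M.rightBehind vbar (f n) s x) = fun _ => False := by
        funext s; simp [Params.rightBehind, hx]
      rw [this]
      exact @measurable_const _ _ _ m _
  have heq : M.pathBehind vbar f n = M.rightBehind vbar (f n) ⁻¹'
      (⋂ i ∈ Set.Iic n, (fun b => detWalk b 0 i) ⁻¹' {f i}) := by
    ext s
    simp [Params.pathBehind]
  rw [heq]
  exact hb (MeasurableSet.biInter (Set.to_countable _) fun i _ =>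
    measurable_detWalk 0 i (measurableSet_singleton _))

theorem localSigma_pastBehind (M : Params) (vbar : ℝ) (f : ℕ → ℤ × ℤ) (n : ℕ) :
    MeasurableSet[localSigma (meets (cone vbar (f n)))ᶜ (backCone vbar (f n))]
      (M.pastBehind vbar f n) := by
  set m := localSigma (meets (cone vbar (f n)))ᶜ (backCone vbar (f n))
  refine @MeasurableSet.inter _ m _ _ (localSigma_pathBehind M vbar f n) ?_
  refine @MeasurableSet.biUnion _ _ m _ _ (Set.to_countable _) fun k _ => ?_
  refine @MeasurableSet.biInter _ _ m _ _ (Set.to_countable _) fun j _ => ?_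
  exact @MeasurableSet.compl _ _ m (localSigma_goodBehind vbar f n _ _)

/-! ### Decomposition at the regeneration time -/

theorem Params.record_eq (M : Params) (vbar : ℝ) (s : Sample) (k : ℕ) :
    M.record vbar s k = pathRecord vbar (M.Y s) k := rfl

theorem Params.regTime_eq_iff (M : Params) (vbar : ℝ) (s : Sample) (n : ℕ) :
    M.regTime vbar s = n ↔ ∃ k : ℕ, M.regIndex vbar s = k ∧ M.record vbar s k = n := by
  unfold Params.regTime
  constructor
  · intro h
    split_ifs at h with hlt
    · exact ⟨_, (ENat.natCast_toNat hlt.ne).symm, h⟩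
    · exact absurd h.symm (ENat.natCast_ne_top n)
  · rintro ⟨k, hk, hr⟩
    rw [hk, if_pos (ENat.natCast_lt_top k)]
    exact hr

theorem Params.regIndex_eq_iff (M : Params) (vbar : ℝ) (s : Sample) (k : ℕ) :
    M.regIndex vbar s = k ↔
      (1 ≤ k ∧ M.record vbar s k < ⊤ ∧ s ∈ M.good vbar (M.Y s (M.record vbar s k).toNat)) ∧
      ∀ j < k, ¬ (1 ≤ j ∧ M.record vbar s j < ⊤ ∧
        s ∈ M.good vbar (M.Y s (M.record vbar s j).toNat)) := by
  rw [Params.regIndex, sInf_coe_image_eq_iff]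
  refine and_congr_right fun _ => forall_congr' fun j => ?_
  simp only [Set.mem_ofPred_eq]
  constructor
  · intro h hj hc; exact absurd (h hc) (by omega)
  · intro h hc; by_contra! hj; exact h hj hc

/-- The hypothesis `hf` says that `f` is stopped at `n`, matching the encoding of the past. -/
theorem Params.past_eq_iff (M : Params) (vbar : ℝ) (s : Sample) {f : ℕ → ℤ × ℤ} {n : ℕ}
    (hf : ∀ i, n ≤ i → f i = f n) :
    M.past vbar s = ((n : ℕ∞), f) ↔ M.regTime vbar s = n ∧ ∀ i ≤ n, M.Y s i = f i := by
  rw [Params.past, Prod.mk.injEq]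
  refine and_congr_right fun h => ?_
  rw [h, funext_iff]
  simp only [Nat.cast_le, ENat.toNat_natCast]
  constructor
  · intro h i hi
    simpa [hi] using h i
  · intro h i
    split_ifs with hi
    · exact h i hi
    · rw [h n le_rfl, hf i (by omega)]

theorem Params.past_eq_iff_pastBehind (M : Params) {vbar : ℝ} (hv : 0 ≤ vbar) (hv1 : vbar ≤ 1)
    (s : Sample) {f : ℕ → ℤ × ℤ} {n : ℕ} (hf : ∀ i, n ≤ i → f i = f n) :
    M.past vbar s = ((n : ℕ∞), f) ↔ s ∈ M.good vbar (f n) ∧ s ∈ M.pastBehind vbar f n := by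
  rw [M.past_eq_iff vbar s hf, Params.regTime_eq_iff]
  simp only [Params.regIndex_eq_iff, Params.record_eq, Params.pastBehind, Set.mem_inter_iff,
    Set.mem_iUnion, Set.mem_iInter, Set.mem_compl_iff, exists_prop, Set.mem_ofPred_eq]
  constructor
  · rintro ⟨⟨k, ⟨⟨hk1, -, hkg⟩, hj⟩, hkn⟩, hY⟩
    rw [hkn, ENat.toNat_natCast, hY n le_rfl] at hkg
    have hkf : pathRecord vbar f k = n := pathRecord_congr hY le_rfl hkn
    refine ⟨hkg, (M.mem_pathBehind_iff hv hkf ((M.mem_good_iff _ _ _).1 hkg).1).2 hY, k,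
      ⟨hk1, hkf⟩, fun j ⟨hj1, hjk⟩ hbad => ?_⟩
    -- Records of smaller index are finite and at most `n`, so `toNat` in `pastBehind` never takes
    -- its default value here.
    obtain ⟨m, hmn, hm⟩ := exists_pathRecord_eq hv1 hjk.le hkf
    have hmY : pathRecord vbar (M.Y s) j = m :=
      pathRecord_congr (fun i hi => (hY i hi).symm) hmn hm
    rw [hm, ENat.toNat_natCast, ← M.mem_good_iff_goodBehind hkg hY hmn, ← hY m hmn] at hbad
    exact hj j hjk ⟨hj1, hmY ▸ ENat.natCast_lt_top m, by rwa [hmY, ENat.toNat_natCast]⟩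
  · rintro ⟨hg, hpath, k, ⟨hk1, hkf⟩, hj⟩
    have hY := (M.mem_pathBehind_iff hv hkf ((M.mem_good_iff _ _ _).1 hg).1).1 hpath
    have hkn : pathRecord vbar (M.Y s) k = n :=
      pathRecord_congr (fun i hi => (hY i hi).symm) le_rfl hkf
    refine ⟨⟨k, ⟨⟨hk1, hkn ▸ ENat.natCast_lt_top n, ?_⟩, fun j hjk ⟨hj1, _, hbad⟩ => ?_⟩, hkn⟩, hY⟩
    · rwa [hkn, ENat.toNat_natCast, hY n le_rfl]
    · obtain ⟨m, hmn, hm⟩ := exists_pathRecord_eq hv1 hjk.le hkf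
      have hmY : pathRecord vbar (M.Y s) j = m :=
        pathRecord_congr (fun i hi => (hY i hi).symm) hmn hm
      refine hj j ⟨hj1, hjk⟩ ?_
      rw [hmY, ENat.toNat_natCast, hY m hmn, M.mem_good_iff_goodBehind hg hY hmn] at hbad
      rwa [hm, ENat.toNat_natCast]

theorem Params.past_inter_future (M : Params) {vbar : ℝ} (hv : 0 ≤ vbar) (hv1 : vbar ≤ 1)
    {f : ℕ → ℤ × ℤ} {n : ℕ} (hf : ∀ i, n ≤ i → f i = f n) (D : Set (ℕ → ℤ × ℤ)) :
    M.past vbar ⁻¹' {((n : ℕ∞), f)} ∩ M.future vbar ⁻¹' D =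
      M.pastBehind vbar f n ∩ M.goodFuture vbar (f n) D := by
  ext s
  simp only [Set.mem_inter_iff, Set.mem_preimage, Set.mem_singleton_iff, Params.goodFuture,
    Set.mem_ofPred_eq]
  have key : M.past vbar s = ((n : ℕ∞), f) →
      M.future vbar s = fun i => M.walk s (f n) i - f n := by
    intro h
    obtain ⟨h1, h2⟩ := (M.past_eq_iff vbar s hf).1 h
    funext i
    have h3 := h2 n le_rfl
    simp only [Params.Y, Params.walk_eq] at h3
    rw [Params.future, h1, ENat.toNat_natCast, h2 n le_rfl, Params.Y, Params.walk_eq,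
      Params.walk_eq, detWalk_add, h3]
  constructor
  · rintro ⟨h, hD⟩
    have h' := (M.past_eq_iff_pastBehind hv hv1 s hf).1 h
    rw [key h] at hD
    exact ⟨h'.2, h'.1, hD⟩
  · rintro ⟨h1, h2, hD⟩
    have h := (M.past_eq_iff_pastBehind hv hv1 s hf).2 ⟨h2, h1⟩
    rw [key h]
    exact ⟨h, hD⟩

/-- The origin is the path point at time `0`, so the conditioning event of `probCone` is treated
like regeneration at an earlier record. -/
theorem Params.good_inter_past (M : Params) {vbar : ℝ} (hv : 0 ≤ vbar) (hv1 : vbar ≤ 1)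
    {f : ℕ → ℤ × ℤ} {n : ℕ} (hf : ∀ i, n ≤ i → f i = f n) :
    M.good vbar 0 ∩ M.past vbar ⁻¹' {((n : ℕ∞), f)} =
      goodBehind vbar f n 0 ∩ M.past vbar ⁻¹' {((n : ℕ∞), f)} := by
  ext s
  simp only [Set.mem_inter_iff, Set.mem_preimage, Set.mem_singleton_iff]
  refine and_congr_left fun h => ?_
  have hg := ((M.past_eq_iff_pastBehind hv hv1 s hf).1 h).1
  have hY := ((M.past_eq_iff vbar s hf).1 h).2
  have h0 : f 0 = 0 := (hY 0 (Nat.zero_le n)).symm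
  rw [← M.mem_good_iff_goodBehind hg hY (Nat.zero_le n), h0]

theorem prob_inter_goodFuture (M : Params) (vbar : ℝ) (y : ℤ × ℤ) {E : Set Sample}
    (hE : MeasurableSet[localSigma (meets (cone vbar y))ᶜ (backCone vbar y)] E)
    {D : Set (ℕ → ℤ × ℤ)} (hD : MeasurableSet D) :
    M.prob (E ∩ M.goodFuture vbar y D) = M.prob E * M.prob (M.goodFuture vbar 0 D) := by
  rw [← prob_goodFuture M vbar y hD]
  exact (Indep_iff _ _ _).1 (indep_localSigma M disjoint_compl_left
    (disjoint_cone_backCone vbar y)) _ _ hE (localSigma_goodFuture M vbar y hD)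

/-! ### Measurability of the regeneration structure -/

theorem measurable_of_preimage_coe {Ω : Type*} [MeasurableSpace Ω] {g : Ω → ℕ∞}
    (h : ∀ m : ℕ, MeasurableSet (g ⁻¹' {(m : ℕ∞)})) : Measurable g := by
  refine measurable_to_countable' fun a => ?_
  induction a with
  | top =>
    have : g ⁻¹' {⊤} = (⋃ m : ℕ, g ⁻¹' {(m : ℕ∞)})ᶜ := by
      ext s
      simp only [Set.mem_preimage, Set.mem_singleton_iff, Set.mem_compl_iff, Set.mem_iUnion]
      rw [← not_ne_iff, not_iff_not, ENat.ne_top_iff_exists]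
      simp only [eq_comm]
    rw [this]
    exact (MeasurableSet.iUnion h).compl
  | coe m => exact h m

theorem measurable_sInf_coe_image {Ω : Type*} [MeasurableSpace Ω] {P : Ω → ℕ → Prop}
    (h : ∀ n, MeasurableSet {s | P s n}) :
    Measurable fun s => sInf ((fun n : ℕ => (n : ℕ∞)) '' {n | P s n}) := by
  refine measurable_of_preimage_coe fun m => ?_
  have : (fun s => sInf ((fun n : ℕ => (n : ℕ∞)) '' {n | P s n})) ⁻¹' {(m : ℕ∞)}
      = {s | P s m} ∩ ⋂ i ∈ Set.Iio m, {s | P s i}ᶜ := by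
    ext s
    simp only [Set.mem_preimage, Set.mem_singleton_iff, sInf_coe_image_eq_iff, Set.mem_inter_iff,
      Set.mem_iInter, Set.mem_compl_iff, Set.mem_ofPred_eq, Set.mem_Iio]
    refine and_congr_right fun _ => forall_congr' fun i => ?_
    constructor
    · intro h hi hc; exact absurd (h hc) (by omega)
    · intro h hc; by_contra! hi; exact h hi hc
  rw [this]
  exact (h m).inter (MeasurableSet.biInter (Set.to_countable _) fun i _ => (h i).compl)

theorem measurableSet_setOf_apply {Ω ι : Type*} [MeasurableSpace Ω] [Countable ι]
    [MeasurableSpace ι] [MeasurableSingletonClass ι] {g : Ω → ι} (hg : Measurable g)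
    {P : Ω → ι → Prop} (h : ∀ i, MeasurableSet {s | P s i}) : MeasurableSet {s | P s (g s)} := by
  have : {s | P s (g s)} = ⋃ i, g ⁻¹' {i} ∩ {s | P s i} := by ext s; simp
  rw [this]
  exact MeasurableSet.iUnion fun i => (hg (measurableSet_singleton i)).inter (h i)

theorem measurable_apply_of_countable {Ω ι β : Type*} [MeasurableSpace Ω] [Countable ι]
    [MeasurableSpace ι] [MeasurableSingletonClass ι] [MeasurableSpace β] {g : Ω → ι}
    (hg : Measurable g) {F : Ω → ι → β} (h : ∀ i, Measurable fun s => F s i) :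
    Measurable fun s => F s (g s) := fun _ hB =>
  measurableSet_setOf_apply (P := fun s i => F s i ∈ _) hg fun i => h i hB

theorem Params.measurable_walk (M : Params) (y : ℤ × ℤ) (n : ℕ) :
    Measurable fun s => M.walk s y n := by
  simp only [Params.walk_eq]
  exact (measurable_detWalk y n).comp (measurable_rightAt M)

theorem Params.measurable_Y (M : Params) : Measurable M.Y :=
  measurable_pi_lambda _ fun n => M.measurable_walk 0 n

theorem Params.measurableSet_good (M : Params) (vbar : ℝ) (y : ℤ × ℤ) :
    MeasurableSet (M.good vbar y) := by
  have : M.good vbar y = M.goodFuture vbar y Set.univ := by simp [Params.goodFuture]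
  rw [this]
  exact localSigma_le _ _ _ (localSigma_goodFuture M vbar y MeasurableSet.univ)

theorem Params.measurable_record (M : Params) (vbar : ℝ) (k : ℕ) :
    Measurable fun s => M.record vbar s k := by
  refine measurable_sInf_coe_image fun n => ?_
  have h : Measurable fun s => M.X s n := measurable_fst.comp (M.measurable_walk 0 n)
  exact h (Set.to_countable {x : ℤ | (1 - vbar) * k + vbar * n ≤ x}).measurableSet

theorem Params.measurable_regIndex (M : Params) (vbar : ℝ) : Measurable (M.regIndex vbar) := by
  refine measurable_sInf_coe_image fun k => ?_
  have hr := M.measurable_record vbar k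
  have hY : Measurable fun s => M.Y s (M.record vbar s k).toNat :=
    measurable_apply_of_countable (F := fun s (a : ℕ∞) => M.Y s a.toNat) hr
      fun a => M.measurable_walk 0 a.toNat
  have h1 : MeasurableSet {s | M.record vbar s k < ⊤} :=
    hr (Set.to_countable {a : ℕ∞ | a < ⊤}).measurableSet
  have h2 : MeasurableSet {s | s ∈ M.good vbar (M.Y s (M.record vbar s k).toNat)} :=
    measurableSet_setOf_apply (P := fun s z => s ∈ M.good vbar z) hY
      fun z => M.measurableSet_good vbar z
  rw [measurableSet_setOfPred] at h1 h2 ⊢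
  exact measurable_const.and (h1.and h2)

theorem Params.measurable_regTime (M : Params) (vbar : ℝ) : Measurable (M.regTime vbar) := by
  refine measurable_of_preimage_coe fun n => ?_
  have : M.regTime vbar ⁻¹' {(n : ℕ∞)} = ⋃ k : ℕ, M.regIndex vbar ⁻¹' {(k : ℕ∞)} ∩
      (fun s => M.record vbar s k) ⁻¹' {(n : ℕ∞)} := by
    ext s
    simp [Params.regTime_eq_iff]
  rw [this]
  exact MeasurableSet.iUnion fun k =>
    (M.measurable_regIndex vbar (measurableSet_singleton _)).inter
      (M.measurable_record vbar k (measurableSet_singleton _))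

theorem Params.measurable_past (M : Params) (vbar : ℝ) : Measurable (M.past vbar) := by
  refine (M.measurable_regTime vbar).prodMk (measurable_pi_lambda _ fun i => ?_)
  refine measurable_apply_of_countable
    (F := fun s (a : ℕ∞) => if (i : ℕ∞) ≤ a then M.Y s i else M.Y s a.toNat)
    (M.measurable_regTime vbar) fun a => ?_
  split_ifs
  · exact M.measurable_walk 0 i
  · exact M.measurable_walk 0 a.toNat

theorem Params.measurable_future (M : Params) (vbar : ℝ) : Measurable (M.future vbar) := by
  refine measurable_pi_lambda _ fun i => ?_
  exact measurable_apply_of_countable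
    (F := fun s (a : ℕ∞) => M.Y s (a.toNat + i) - M.Y s a.toNat) (M.measurable_regTime vbar)
    fun a => (M.measurable_walk 0 (a.toNat + i)).sub (M.measurable_walk 0 a.toNat)

/-! ### Conditional laws at atoms -/

/-- At an atom the conditional law is a ratio in which `c` cancels, so `c` need not be identified. A
value of positive probability also forces `ν Set.univ ≠ 0`; hence positivity of the regeneration
probability needs no separate proof. -/
theorem condDistrib_eq_cond_map {Ω α β : Type*} [MeasurableSpace Ω] [MeasurableSpace α]
    [MeasurableSpace β] [MeasurableSingletonClass α] [StandardBorelSpace β] [Nonempty β]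
    {μ : Measure Ω} [IsFiniteMeasure μ] {X : Ω → α} {Z : Ω → β} (hX : Measurable X)
    (hZ : Measurable Z) {ν : Measure β} {S : Set α} (hS : S.Countable)
    (h : ∀ p ∈ S, ∃ c : ℝ≥0∞, ∀ D, MeasurableSet D → μ (X ⁻¹' {p} ∩ Z ⁻¹' D) = c * ν D) :
    ∀ᵐ s ∂μ, X s ∈ S → condDistrib Z X μ (X s) = (ν Set.univ)⁻¹ • ν := by
  -- Countability of `S` allows all values of probability zero to be discarded at once.
  have h0 : ∀ᵐ s ∂μ, ∀ p ∈ S, μ (X ⁻¹' {p}) = 0 → X s ≠ p := by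
    rw [ae_ball_iff hS]
    intro p _
    by_cases hp : μ (X ⁻¹' {p}) = 0
    · have : ∀ᵐ s ∂μ, X s ≠ p := by rw [ae_iff]; simpa [Set.preimage] using hp
      filter_upwards [this] with s hs _ using hs
    · exact Filter.Eventually.of_forall fun s h => absurd h hp
  filter_upwards [h0] with s hs hsS
  obtain ⟨c, hc⟩ := h (X s) hsS
  have hpos : μ (X ⁻¹' {X s}) ≠ 0 := fun h => hs (X s) hsS h rfl
  have huniv := hc Set.univ MeasurableSet.univ
  rw [Set.preimage_univ, Set.inter_univ] at huniv
  have hfin := measure_ne_top μ (X ⁻¹' {X s})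
  rw [huniv] at hpos hfin
  have hc0 : c ≠ 0 := left_ne_zero_of_mul hpos
  have hν0 : ν Set.univ ≠ 0 := right_ne_zero_of_mul hpos
  have hct : c ≠ ∞ := fun h => hfin (by rw [h, ENNReal.top_mul hν0])
  have hmap : μ.map X {X s} = c * ν Set.univ := by
    rw [Measure.map_apply hX (measurableSet_singleton _), huniv]
  ext D hD
  rw [condDistrib_apply_of_ne_zero hZ _ (by rwa [hmap]), hmap,
    Measure.map_apply (hX.prodMk hZ) ((measurableSet_singleton _).prod hD),
    show (fun a => (X a, Z a)) ⁻¹' ({X s} ×ˢ D) = X ⁻¹' {X s} ∩ Z ⁻¹' D from rfl, hc D hD,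
    Measure.smul_apply, smul_eq_mul, ENNReal.mul_inv (.inl hc0) (.inl hct),
    mul_mul_mul_comm, ENNReal.inv_mul_cancel hc0 hct, one_mul]

/-- The possible values of the past on the event of a finite regeneration time. -/
def finitePasts : Set (ℕ∞ × (ℕ → ℤ × ℤ)) :=
  {p | ∃ n : ℕ, p.1 = n ∧ ∀ i, n ≤ i → p.2 i = p.2 n}

theorem countable_finitePasts : finitePasts.Countable := by
  refine Set.Countable.mono (s₂ := Set.range fun l : List (ℤ × ℤ) × ℕ =>
    ((l.2 : ℕ∞), fun i => l.1.getD (min i l.2) 0)) ?_ (Set.countable_range _)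
  rintro ⟨a, f⟩ ⟨n, rfl, hf⟩
  -- The list records times `0` to `n` inclusive; since `min i n < n + 1`, the default of `getD` is
  -- never read.
  refine ⟨(List.ofFn fun i : Fin (n + 1) => f i, n), Prod.ext rfl (funext fun i => ?_)⟩
  have hlt : min i n < n + 1 := by omega
  simp only [List.getD_eq_getElem?_getD, List.getElem?_ofFn, hlt, dif_pos, Option.getD_some]
  rcases le_total i n with h | h
  · rw [min_eq_left h]
  · rw [min_eq_right h]; exact (hf i h).symm

theorem Params.past_mem_finitePasts (M : Params) {vbar : ℝ} {s : Sample}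
    (h : M.regTime vbar s < ⊤) : M.past vbar s ∈ finitePasts := by
  obtain ⟨n, hn⟩ := ENat.ne_top_iff_exists.1 h.ne
  refine ⟨n, hn.symm, fun i hi => ?_⟩
  simp only [Params.past, ← hn, Nat.cast_le, ENat.toNat_natCast, le_refl, if_true]
  split_ifs with hin
  · rw [le_antisymm hin hi]
  · rfl

theorem probCone_map_Y (M : Params) (vbar : ℝ) :
    (M.probCone vbar).map M.Y =
      (((M.prob.restrict (M.good vbar 0)).map M.Y) Set.univ)⁻¹ •
        (M.prob.restrict (M.good vbar 0)).map M.Y := by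
  rw [Params.probCone, ProbabilityTheory.cond, Measure.map_smul,
    Measure.map_apply M.measurable_Y MeasurableSet.univ, Set.preimage_univ,
    Measure.restrict_apply_univ]

theorem restrict_good_map_Y (M : Params) (vbar : ℝ) {D : Set (ℕ → ℤ × ℤ)} (hD : MeasurableSet D) :
    (M.prob.restrict (M.good vbar 0)).map M.Y D = M.prob (M.goodFuture vbar 0 D) := by
  rw [Measure.map_apply M.measurable_Y hD, Measure.restrict_apply (M.measurable_Y hD),
    Set.inter_comm, Params.goodFuture]
  simp only [sub_zero]
  rfl

end RWDRE

theorem theoremt (M : RWDRE.Params) (vstar vbar : ℝ) (hpos : 0 < vstar) (hlt : vstar < M.vOcc)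
    (hball : M.Ballistic vstar) (hvbar : vbar = vstar / 3) :
    (∀ᵐ s ∂M.prob, M.regTime vbar s < ⊤ →
      condDistrib (M.future vbar) (M.past vbar) M.prob (M.past vbar s)
        = (M.probCone vbar).map M.Y) ∧
    (∀ᵐ s ∂(M.probCone vbar), M.regTime vbar s < ⊤ →
      condDistrib (M.future vbar) (M.past vbar) (M.probCone vbar) (M.past vbar s)
        = (M.probCone vbar).map M.Y) := by
  have hv0 : 0 ≤ vbar := by rw [hvbar]; linarith
  have hv1 : vbar ≤ 1 := by
    have h1 := M.pOcc_mem.2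
    unfold RWDRE.Params.vOcc at hlt
    rw [hvbar]
    linarith
  rw [RWDRE.probCone_map_Y]
  constructor
  · have h := RWDRE.condDistrib_eq_cond_map (μ := M.prob) (M.measurable_past vbar)
      (M.measurable_future vbar) (ν := (M.prob.restrict (M.good vbar 0)).map M.Y)
      RWDRE.countable_finitePasts ?_
    · filter_upwards [h] with s hs hfin using hs (M.past_mem_finitePasts hfin)
    · rintro ⟨_, f⟩ ⟨n, rfl, hf⟩
      refine ⟨M.prob (M.pastBehind vbar f n), fun D hD => ?_⟩
      rw [M.past_inter_future hv0 hv1 hf, RWDRE.restrict_good_map_Y M vbar hD,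
        RWDRE.prob_inter_goodFuture M vbar _ (RWDRE.localSigma_pastBehind M vbar f n) hD]
  · have h := RWDRE.condDistrib_eq_cond_map (μ := M.probCone vbar) (M.measurable_past vbar)
      (M.measurable_future vbar) (ν := (M.prob.restrict (M.good vbar 0)).map M.Y)
      RWDRE.countable_finitePasts ?_
    · filter_upwards [h] with s hs hfin using hs (M.past_mem_finitePasts hfin)
    · rintro ⟨_, f⟩ ⟨n, rfl, hf⟩
      -- The constant combines the normalisation of `probCone` with both events behind `f n`:
      -- goodness at the origin and the prescribed past.
      refine ⟨(M.prob (M.good vbar 0))⁻¹ *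
        M.prob (RWDRE.goodBehind vbar f n 0 ∩ M.pastBehind vbar f n), fun D hD => ?_⟩
      rw [RWDRE.Params.probCone, ProbabilityTheory.cond_apply (M.measurableSet_good vbar 0),
        ← Set.inter_assoc, M.good_inter_past hv0 hv1 hf, Set.inter_assoc,
        M.past_inter_future hv0 hv1 hf, ← Set.inter_assoc,
        RWDRE.restrict_good_map_Y M vbar hD, RWDRE.prob_inter_goodFuture M vbar _
          (@MeasurableSet.inter _ (RWDRE.localSigma _ _) _ _
            (RWDRE.localSigma_goodBehind vbar f n 0 _)
            (RWDRE.localSigma_pastBehind M vbar f n)) hD, mul_assoc]
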